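/- Let $\nu$ be a measure on a measurable space $\mathcal X$, $f\ge 0$ a $\nu$-integrable unnormalised density and $\pi=f/\int f\,d\nu$. Let $\mathcal X_1,\dots,\mathcal X_K$ ($K\ge1$) be a measurable partition of $\mathcal X$, and let $g_a\ge 0$ satisfy $\int_{\mathcal X_a}g_a\,d\nu=1$ and $f=0$ a.e. on $\mathcal X_a\cap\{g_a=0\}$. For cell probabilities $q=(q_a)_{a=1}^K$ let $q(x)=\sum_a q_a g_a(x)\mathbf 1_{\mathcal X_a}(x)$. Fix $\alpha\in(0,2]$. The $\alpha$-loss of $q$ is $$\mathcal L_\alpha(q)=D_\alpha(\pi\|q)=\int \ell_\alpha\!\left(\tfrac{\pi(x)}{q(x)}\right)q(x)\,d\nu(x),\qquad \ell_\alpha(r)=\frac{\alpha r+(1-\alpha)-r^\alpha}{\alpha(1-\alpha)}\ (\alpha\ne 1),\quad \ell_1(r)=r\log r+1-r,$$ so that $\mathcal L_1(q)=\mathrm{KL}(\pi\|q)$. The regret is $R(q)=\mathcal L_\alpha(q)-\mathcal L_\alpha(q^*)$, where $q^*_a\propto(\pi_a^{(\alpha)})^{1/\alpha}$ and $\pi^{(\alpha)}_a=\int_{\mathcal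 X_a}\pi^\alpha g_a^{1-\alpha}d\nu$. Put $Z_a=\int_{\mathcal X_a}(f/g_a)^\alpha g_a\,d\nu$ and $Z=(\int f\,d\nu)^\alpha$, so $Z_a=Z\,\pi_a^{(\alpha)}$. Assume $Z_a>0$ for all $a$, and that for $x\sim g_a$ the weight $(f(x)/g_a(x))^\alpha$ is sub-Gaussian with variance factor $\tau_a^2$, $\tau_a\ge 0$, i.e. its centred moment generating function at $\theta$ is at most $e^{\tau_a^2\theta^2/2}$ for all $\theta\in\mathbb R$. The $\alpha$-modified Daisee algorithm draws one sample from each $g_a$ in rounds $1,\dots,K$. In round $t>K$, with $N_{at}$ the number of earlier rounds in which arm $a$ was chosen, $\hat Z_{at}$ the average of $(f(x_l)/g_a(x_l))^\alpha$ over the earlier rounds $l$ with arm $a$, $\sigma_{at}=c\,\tau_a\sqrt{\log t/N_{at}}$ and $c=\sqrt{4.14\log_2(2e)}$, it draws, conditionally on the past, an arm $A_t$ with probabilities $$q_{at}=\frac{(\hat Z_{at}+\sigma_{at})^{1/\alpha}}{\sum_{b=1}^K(\hat Z_{bt}+\sigma_{bt})^{1/\alpha}}$$ and then $x_t\sim g_{A_t}$.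 Put $R_t=R(q_t)$ and $$M_t=\frac{2^{\frac1{2\alpha}+2}c^{\frac1{2\alpha}+1}K^{1/2}}{\alpha^2 Z\sqrt t}\Big(\sum_a\tau_aZ_a^{\frac1{2\alpha}-1}\Big)\sqrt{\sum_a\tau_a^{1/\alpha}}\,(\log t)^{\frac12(\frac1{2\alpha}+1)}.$$ Then for every $t>K$ the regret $R_t$ is integrable and $\mathbb E[R_t]\le M_t+\varepsilon_t$, where $\varepsilon_t=o\big(t^{-1/2}(\log t)^{\frac12(\frac1{2\alpha}+1)}\big)$. Moreover, $\mathbb E[R_t]\le M_t$ for all $t>K$ with $t\ge t_0$, and $$\sum_{t=K+1}^T\mathbb E[R_t]\le C\sqrt T\,(\log T)^{\frac12(\frac1{2\alpha}+1)}\qquad\text{for all }T>K.$$ Here $(\varepsilon_t)$, $t_0$ and $C$ depend only on $K$, $\alpha$, $Z$, $(Z_a)$ and $(\tau_a)$. As $\alpha\to1$, the rate $\sqrt T(\log T)^{\frac12(\frac1{2\alpha}+1)}$ tends to the rate $\sqrt T(\log T)^{3/4}$ of the KL case, and $\ell_\alpha(r)\to\ell_1(r)$ for every $r\ge0$. -/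

import Mathlib

open MeasureTheory ProbabilityTheory Filter Topology Asymptotics
open scoped NNReal ENNReal

noncomputable section

namespace Daisee

/-- The pointwise `β`-loss as a function of the density ratio `r = π(x)/q(x)`:
`(β r + (1 - β) - r ^ β) / (β (1 - β))`. At `β = 1` it is the limit `r log r + 1 - r`
(`InformationTheory.klFun`), the integrand of the Kullback-Leibler divergence. -/
def alphaLoss (β r : ℝ) : ℝ :=
  if β = 1 then InformationTheory.klFun r
  else (β * r + (1 - β) - r ^ β) / (β * (1 - β))

/-- The data of the importance sampling problem: a reference measure `ν` ("`dx`") on the sample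
space, an unnormalised target density `f`, a measurable partition of the sample space into `K`
cells, and on each cell a proposal density `g a` which covers the target there. -/
structure Problem (K : ℕ) (𝒳 : Type*) [MeasurableSpace 𝒳] where
  ν : Measure 𝒳
  f : 𝒳 → ℝ
  cell : Fin K → Set 𝒳
  g : Fin K → 𝒳 → ℝ
  measurable_f : Measurable f
  f_nonneg : ∀ x, 0 ≤ f x
  integrable_f : Integrable f ν
  measurableSet_cell : ∀ a, MeasurableSet (cell a)
  disjoint_cell : Pairwise fun a b => Disjoint (cell a) (cell b)
  iUnion_cell : ⋃ a, cell a = Set.univ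
  measurable_g : ∀ a, Measurable (g a)
  g_nonneg : ∀ a x, 0 ≤ g a x
  integral_g : ∀ a, ∫ x in cell a, g a x ∂ν = 1
  g_covers : ∀ a, ∀ᵐ x ∂(ν.restrict (cell a)), g a x = 0 → f x = 0

variable {K : ℕ} {𝒳 : Type*} [MeasurableSpace 𝒳]

namespace Problem

variable (P : Problem K 𝒳)

/-- The normalised target density `π = f / ∫ f`. -/
def target (x : 𝒳) : ℝ := P.f x / ∫ y, P.f y ∂P.ν

/-- The law on the sample space with density `g a` on the cell of arm `a`. -/
def armLaw (a : Fin K) : Measure 𝒳 :=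
  (P.ν.restrict (P.cell a)).withDensity fun x => ENNReal.ofReal (P.g a x)

/-- The localised weight `(f / g a) ^ α`. -/
def weight (α : ℝ) (a : Fin K) (x : 𝒳) : ℝ := (P.f x / P.g a x) ^ α

/-- `Z_a = ∫_{cell a} (f / g a) ^ α g a`. -/
def localMass (α : ℝ) (a : Fin K) : ℝ := ∫ x in P.cell a, P.weight α a x * P.g a x ∂P.ν

/-- `π_a^{(α)} = ∫_{cell a} π ^ α (g a) ^ (1 - α)`. -/
def targetMass (α : ℝ) (a : Fin K) : ℝ :=
  ∫ x in P.cell a, P.target x ^ α * P.g a x ^ (1 - α) ∂P.ν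

/-- The constant `Z` with `Z_a = Z π_a^{(α)}` for all `a`, namely `(∫ f) ^ α`. -/
def normConst (α : ℝ) : ℝ := (∫ x, P.f x ∂P.ν) ^ α

/-- The proposal density `∑ a, w a * g a * 1_{cell a}` with cell probabilities `w`. -/
def proposal (w : Fin K → ℝ) (x : 𝒳) : ℝ := ∑ a, w a * (P.cell a).indicator (P.g a) x

/-- The `α`-divergence `D_α(π ‖ q)`: the expected pointwise `α`-loss for `x` drawn from `q`. -/
def loss (α : ℝ) (q : 𝒳 → ℝ) : ℝ := ∫ x, alphaLoss α (P.target x / q x) * q x ∂P.ν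

/-- The optimal cell probabilities, proportional to `(π_a^{(α)}) ^ (1 / α)`. -/
def optimal (α : ℝ) (a : Fin K) : ℝ :=
  P.targetMass α a ^ (1 / α) / ∑ b, P.targetMass α b ^ (1 / α)

/-- The regret of the cell probabilities `w` for the `α`-loss. -/
def regret (α : ℝ) (w : Fin K → ℝ) : ℝ :=
  P.loss α (P.proposal w) - P.loss α (P.proposal (P.optimal α))

/-- Sub-Gaussianity of the localised weights: for `x` drawn from `g a`, the centred weight of
arm `a` is sub-Gaussian with variance factor `(τ a) ^ 2`. -/
def SubGaussianWeights (α : ℝ) (τ : Fin K → ℝ≥0) : Prop :=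
  ∀ a, HasSubgaussianMGF (fun x => P.weight α a x - ∫ y, P.weight α a y ∂P.armLaw a)
    (τ a ^ 2) (P.armLaw a)

end Problem

/-- The constant `c = √(4.14 log₂(2e))` of the optimism boost. -/
def boostConst : ℝ := Real.sqrt (4.14 * Real.logb 2 (2 * Real.exp 1))

/-- `N_{at}`: how often arm `a` was chosen in the rounds `1, …, t - 1`, which precede the choice
of the proposal of round `t`. -/
def pulls (A : ℕ → Fin K) (a : Fin K) (t : ℕ) : ℕ :=
  ((Finset.Ico 1 t).filter fun l => A l = a).card

/-- The optimism boost `σ_{at} = c τ_a √(log t / N_{at})`. -/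
def boost (τ : Fin K → ℝ≥0) (A : ℕ → Fin K) (a : Fin K) (t : ℕ) : ℝ :=
  boostConst * (τ a : ℝ) * Real.sqrt (Real.log t / pulls A a t)

namespace Problem

variable (P : Problem K 𝒳)

/-- The estimate of `Z_a` available for the proposal of round `t`: the average of the localised
weights of the samples drawn from arm `a` in the rounds `1, …, t - 1`. -/
def estimate (α : ℝ) (A : ℕ → Fin K) (X : ℕ → 𝒳) (a : Fin K) (t : ℕ) : ℝ :=
  (∑ l ∈ (Finset.Ico 1 t).filter fun l => A l = a, P.weight α a (X l)) / pulls A a t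

/-- The cell probabilities of the algorithm in round `t`. The rounds `1, …, K` draw once from each
arm in turn; afterwards arm `a` has probability proportional to
`(estimate + boost) ^ (1 / α)`. -/
def armProb (α : ℝ) (τ : Fin K → ℝ≥0) (A : ℕ → Fin K) (X : ℕ → 𝒳) (t : ℕ) (a : Fin K) : ℝ :=
  if t ≤ K then (if (a : ℕ) + 1 = t then 1 else 0)
  else (P.estimate α A X a t + boost τ A a t) ^ (1 / α) /
    ∑ b, (P.estimate α A X b t + boost τ A b t) ^ (1 / α)

end Problem

/-- The information generated by arms and samples of the rounds `1, …, t - 1`. -/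
abbrev past {Ω : Type*} (A : ℕ → Ω → Fin K) (X : ℕ → Ω → 𝒳) (t : ℕ) : MeasurableSpace Ω :=
  ⨆ l ∈ Finset.Ico 1 t, MeasurableSpace.comap (fun ω => (A l ω, X l ω)) inferInstance

/-- `(A, X)` is a run of the algorithm under `μ`: given the past, the arm of round `t` is `a` with
probability `armProb … t a`, and the sample is then drawn from the law of that arm. -/
structure IsRun (P : Problem K 𝒳) (α : ℝ) (τ : Fin K → ℝ≥0) {Ω : Type*} [MeasurableSpace Ω]
    (μ : Measure Ω) (A : ℕ → Ω → Fin K) (X : ℕ → Ω → 𝒳) : Prop where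
  measurable_arm : ∀ t, Measurable (A t)
  measurable_sample : ∀ t, Measurable (X t)
  step : ∀ t, 1 ≤ t → ∀ a, ∀ B : Set 𝒳, MeasurableSet B →
    μ⟦{ω | A t ω = a ∧ X t ω ∈ B} | past A X t⟧ =ᵐ[μ]
      fun ω => P.armProb α τ (fun l => A l ω) (fun l => X l ω) t a * (P.armLaw a).real B

/-- The (random) instantaneous regret of round `t` of a run. -/
def runRegret (P : Problem K 𝒳) (α : ℝ) (τ : Fin K → ℝ≥0) {Ω : Type*}
    (A : ℕ → Ω → Fin K) (X : ℕ → Ω → 𝒳) (t : ℕ) (ω : Ω) : ℝ :=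
  P.regret α (P.armProb α τ (fun l => A l ω) (fun l => X l ω) t)

/-- The exponent `(1 / (2 α) + 1) / 2` of the logarithm. -/
def logExponent (α : ℝ) : ℝ := (1 / (2 * α) + 1) / 2

/-- The rate `t ^ (-1/2) (log t) ^ ((1 / (2 α) + 1) / 2)`. -/
def rate (α : ℝ) (t : ℕ) : ℝ := (Real.sqrt t)⁻¹ * Real.log t ^ logExponent α

/-- The cumulative rate `√T (log T) ^ ((1 / (2 α) + 1) / 2)`. -/
def cumulativeRate (α : ℝ) (T : ℕ) : ℝ := Real.sqrt T * Real.log T ^ logExponent α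

/-- The explicit factor in front of the rate, as a function of `α`, `Z`, `Z_a` and `τ_a`. -/
def leadingConst (α Z : ℝ) (ζ : Fin K → ℝ) (τ : Fin K → ℝ≥0) : ℝ :=
  (2 : ℝ) ^ (1 / (2 * α) + 2) * boostConst ^ (1 / (2 * α) + 1) * Real.sqrt K / (α ^ 2 * Z) *
    (∑ a, (τ a : ℝ) * ζ a ^ (1 / (2 * α) - 1)) * Real.sqrt (∑ a, (τ a : ℝ) ^ (1 / α))

end Daisee

end

/-! ### The pointwise loss: upper bounds and the limit at exponent one. -/

namespace Daisee

/-! The expected regret of round $t$ is in fact at most $C t^{-5/8}$, a power of $t$ below the rate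
in the statement. Hence $\varepsilon_t = C t^{-5/8}$ suffices by itself, $M_t$ only enters as a
nonnegative term, and the bound by $M_t$ alone holds eventually as soon as some $\tau_a$ is
positive. If all $\tau_a$ vanish then $M_t = 0$, but then the estimates are almost surely exact and
the expected regret is nonpositive.

The gain comes from treating the regret as a quadratic quantity. By `Problem.regret_eq` it is a
constant times the $\alpha$-divergence of the cell probabilities $w$ from the optimal ones $p$.
Since $\ell_\alpha(r) \le (1 + 1/\alpha)(r-1)^2$ (`alphaLoss_le_sq`, where $\alpha \le 2$ is
needed), this divergence is at most a multiple of $\sum_a (p_a - w_a)^2 / w_a$. When all estimates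
are within their boosts, the scores lie between $Z_a$ and $Z_a + O(\sqrt{\log t})$. Every cell
probability is then at least $c t^{-1/8}$ (`exists_prob_lower_bound`), and the divergence is at most
$C t^{1/8} \sum_a \sigma_a^2$ (`exists_divergence_le_sq`), that is, of order $t^{1/8} \log t \sum_a
1/N_a$.

The estimates fail to be this accurate with probability at most $2K/t^4$
(`IsRun.measure_compl_accurate_le`), by an exponential supermartingale and a union bound over the
number of pulls. The same lower bound on the probabilities gives the mean of $1/N_a$ a negative
drift of order $t^{-1/8}\,\mathbb E[N_a^{-2}]$, and the resulting recursion yields $\mathbb E[1/N_a]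
= O(t^{-7/8})$ (`exists_recursion_bound`). Paying $t^{1/8}$ for the divergence and $t^{1/8}$ for the
logarithm leaves $t^{-5/8}$. Off the accurate event a crude polynomial bound
(`exists_divergence_le`), combined with second moments of the estimates, contributes only $O(1/t)$.
-/

theorem alphaLoss_one (r : ℝ) : alphaLoss 1 r = InformationTheory.klFun r := by
  simp [alphaLoss]

theorem alphaLoss_of_ne {α : ℝ} (h : α ≠ 1) (r : ℝ) :
    alphaLoss α r = (α * r + (1 - α) - r ^ α) / (α * (1 - α)) := by
  simp [alphaLoss, h]

theorem measurable_alphaLoss (α : ℝ) : Measurable (alphaLoss α) := by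
  by_cases h : α = 1
  · subst h
    simpa only [funext alphaLoss_one] using InformationTheory.measurable_klFun
  · simp only [funext (alphaLoss_of_ne h)]
    fun_prop

theorem alphaLoss_nonneg {α r : ℝ} (hα : 0 < α) (hr : 0 ≤ r) : 0 ≤ alphaLoss α r := by
  rcases lt_trichotomy α 1 with h | rfl | h
  · rw [alphaLoss_of_ne h.ne]
    have := rpow_one_add_le_one_add_mul_self (s := r - 1) (by linarith) hα.le h.le
    rw [add_sub_cancel] at this
    exact div_nonneg (by linarith) (mul_nonneg hα.le (by linarith))
  · rw [alphaLoss_one]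
    exact InformationTheory.klFun_nonneg hr
  · rw [alphaLoss_of_ne h.ne']
    have := one_add_mul_self_le_rpow_one_add (s := r - 1) (by linarith) h.le
    rw [add_sub_cancel] at this
    exact div_nonneg_of_nonpos (by linarith) (mul_nonpos_of_nonneg_of_nonpos hα.le (by linarith))

/-- Bernoulli's inequality for an exponent in $[0,1]$: applied to $r^{1-\alpha}$ if $\alpha < 1$,
which bounds $r^\alpha$ from below by $r/(\alpha + (1-\alpha) r)$, and to $r^{\alpha-1}$ if $\alpha
> 1$, which needs $\alpha \le 2$. At $\alpha = 1$ it is $\log r \le r - 1$. The constant is the sum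
of those of the cases. -/
theorem alphaLoss_le_sq {α r : ℝ} (hα : 0 < α) (hα2 : α ≤ 2) (hr : 0 ≤ r) :
    alphaLoss α r ≤ (1 + 1 / α) * (r - 1) ^ 2 := by
  have key : alphaLoss α r ≤ (r - 1) ^ 2 ∨ alphaLoss α r ≤ 1 / α * (r - 1) ^ 2 := by
    rcases lt_trichotomy α 1 with h | rfl | h
    · right
      rw [alphaLoss_of_ne h.ne]
      have hB := rpow_one_add_le_one_add_mul_self (s := r - 1) (p := 1 - α)
        (by linarith) (by linarith) (by linarith)
      rw [add_sub_cancel] at hB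
      have hd : 0 < α + (1 - α) * r := by nlinarith
      have h1 : r / (α + (1 - α) * r) ≤ r ^ α := by
        rw [div_le_iff₀ hd]
        rcases hr.eq_or_lt with rfl | hr'
        · simp [Real.zero_rpow hα.ne']
        · calc r = r ^ α * r ^ (1 - α) := by rw [← Real.rpow_add hr']; simp
            _ ≤ r ^ α * (α + (1 - α) * r) := by gcongr; linarith
      have h2 : α * r + (1 - α) - r / (α + (1 - α) * r)
          = α * (1 - α) * ((r - 1) ^ 2 / (α + (1 - α) * r)) := by
        field_simp
        ring
      have h3 : (r - 1) ^ 2 / (α + (1 - α) * r) ≤ 1 / α * (r - 1) ^ 2 := by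
        rw [one_div_mul_eq_div]
        gcongr
        nlinarith
      have h4 : 0 < α * (1 - α) := mul_pos hα (by linarith)
      rw [div_le_iff₀ h4]
      nlinarith
    · left
      rw [alphaLoss_one, InformationTheory.klFun]
      rcases hr.eq_or_lt with rfl | hr'
      · simp
      · nlinarith [Real.log_le_sub_one_of_pos hr']
    · right
      rw [alphaLoss_of_ne h.ne']
      have hB := rpow_one_add_le_one_add_mul_self (s := r - 1) (p := α - 1)
        (by linarith) (by linarith) (by linarith)
      rw [add_sub_cancel] at hB
      have h1 : r ^ α ≤ r * (1 + (α - 1) * (r - 1)) := by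
        rcases hr.eq_or_lt with rfl | hr'
        · simp [Real.zero_rpow hα.ne']
        · calc r ^ α = r * r ^ (α - 1) := by
                rw [← Real.rpow_one_add' hr (by linarith)]; simp
            _ ≤ _ := by gcongr
      rw [div_le_iff_of_neg (by nlinarith)]
      have : 1 / α * (r - 1) ^ 2 * (α * (1 - α)) = (1 - α) * (r - 1) ^ 2 := by
        field_simp
      rw [this]
      nlinarith
  have h0 : 0 ≤ 1 / α := by positivity
  rcases key with h | h
  · nlinarith [mul_nonneg h0 (sq_nonneg (r - 1))]
  · nlinarith [sq_nonneg (r - 1)]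

/-- Drop the term $-r^\alpha$. After averaging over cell probabilities this bounds the divergence by
a constant when $\alpha < 1$. -/
theorem alphaLoss_le_linear {α r : ℝ} (hα : 0 < α) (hα1 : α < 1) (hr : 0 ≤ r) :
    alphaLoss α r ≤ 1 / α + r / (1 - α) := by
  have h1 : 0 < 1 - α := by linarith
  rw [alphaLoss_of_ne hα1.ne, div_le_iff₀ (mul_pos hα h1)]
  have : (1 / α + r / (1 - α)) * (α * (1 - α)) = (1 - α) + α * r := by
    field_simp
  rw [this]
  linarith [Real.rpow_nonneg hr α]

/-- The numerator vanishes at $\beta = 1$, so the loss is its difference quotient there divided by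
$-\beta$, and the limit is minus the derivative. -/
theorem tendsto_alphaLoss {r : ℝ} (hr : 0 ≤ r) :
    Tendsto (fun β => alphaLoss β r) (𝓝[≠] 1) (𝓝 (alphaLoss 1 r)) := by
  have hd : HasDerivAt (fun β : ℝ => β * r + (1 - β) - r ^ β) (r - 1 - r * Real.log r) 1 := by
    have h1 : HasDerivAt (fun β : ℝ => r ^ β) (r * Real.log r) 1 := by
      rcases hr.eq_or_lt with rfl | hr'
      · have : (fun β : ℝ => (0 : ℝ) ^ β) =ᶠ[𝓝 1] fun _ => 0 := by
          filter_upwards [eventually_ne_nhds (one_ne_zero (α := ℝ))] with β hβ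
          exact Real.zero_rpow hβ
        simpa using (hasDerivAt_const (1 : ℝ) (0 : ℝ)).congr_of_eventuallyEq this
      · simpa using Real.hasStrictDerivAt_const_rpow hr' 1 |>.hasDerivAt
    have h2 := (((hasDerivAt_id (1 : ℝ)).mul_const r).add
      ((hasDerivAt_id (1 : ℝ)).const_sub 1)).sub h1
    refine h2.congr_deriv ?_
    ring
  have hs := hd.tendsto_slope
  have hβ : Tendsto (fun β : ℝ => -β) (𝓝[≠] 1) (𝓝 (-1)) :=
    (continuous_neg.tendsto 1).mono_left nhdsWithin_le_nhds
  have := hs.div hβ (by norm_num)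
  have hval : (r - 1 - r * Real.log r) / (-1) = alphaLoss 1 r := by
    rw [alphaLoss_one, InformationTheory.klFun]; ring
  rw [hval] at this
  refine this.congr' ?_
  filter_upwards [self_mem_nhdsWithin,
    nhdsWithin_le_nhds (eventually_ne_nhds (one_ne_zero (α := ℝ)))] with β hβ hβ0
  have hβ' : β ≠ 1 := hβ
  rw [alphaLoss_of_ne hβ', Pi.div_apply, slope_def_field, div_div]
  simp only [Real.rpow_one]
  congr 1 <;> ring

theorem tendsto_cumulativeRate (T : ℕ) : Tendsto (fun β => cumulativeRate β T) (𝓝 1)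
    (𝓝 (Real.sqrt T * Real.log T ^ (3 / 4 : ℝ))) := by
  unfold cumulativeRate logExponent
  refine Tendsto.const_mul _ (Tendsto.rpow tendsto_const_nhds ?_ (Or.inr (by norm_num)))
  have : ContinuousAt (fun β : ℝ => (1 / (2 * β) + 1) / 2) 1 := by
    fun_prop (disch := norm_num)
  convert this.tendsto using 2
  norm_num

end Daisee

/-! ### The regret as a divergence between cell probabilities. -/

namespace Daisee

namespace Problem

variable {K : ℕ} {𝒳 : Type*} [MeasurableSpace 𝒳] (P : Problem K 𝒳) {α : ℝ}

theorem measurable_weight (α : ℝ) (a : Fin K) : Measurable (P.weight α a) :=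
  (P.measurable_f.div (P.measurable_g a)).pow_const α

theorem weight_nonneg (α : ℝ) (a : Fin K) (x : 𝒳) : 0 ≤ P.weight α a x :=
  Real.rpow_nonneg (div_nonneg (P.f_nonneg x) (P.g_nonneg a x)) α

/-- The Bochner integral of a non-integrable function is $0$ by convention, so an integral equal to
$1$ forces integrability. -/
theorem integrableOn_g (a : Fin K) : IntegrableOn (P.g a) (P.cell a) P.ν := by
  by_contra h
  have := P.integral_g a
  rw [integral_undef h] at this
  exact zero_ne_one this

instance isProbabilityMeasure_armLaw (a : Fin K) : IsProbabilityMeasure (P.armLaw a) := by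
  constructor
  rw [armLaw, withDensity_apply _ MeasurableSet.univ, Measure.restrict_univ,
    ← ofReal_integral_eq_lintegral_ofReal (P.integrableOn_g a)
      (Eventually.of_forall (P.g_nonneg a)), P.integral_g a, ENNReal.ofReal_one]

theorem integral_armLaw (a : Fin K) (h : 𝒳 → ℝ) :
    ∫ x, h x ∂P.armLaw a = ∫ x in P.cell a, P.g a x * h x ∂P.ν := by
  rw [armLaw, integral_withDensity_eq_integral_toReal_smul (P.measurable_g a).ennreal_ofReal
    (by simp)]
  simp [ENNReal.toReal_ofReal (P.g_nonneg a _)]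

theorem integrable_armLaw_iff (a : Fin K) (h : 𝒳 → ℝ) :
    Integrable h (P.armLaw a) ↔ IntegrableOn (fun x => P.g a x * h x) (P.cell a) P.ν := by
  rw [armLaw, integrable_withDensity_iff_integrable_smul' (P.measurable_g a).ennreal_ofReal
    (by simp)]
  simp [ENNReal.toReal_ofReal (P.g_nonneg a _), IntegrableOn]

theorem localMass_eq (α : ℝ) (a : Fin K) :
    P.localMass α a = ∫ x, P.weight α a x ∂P.armLaw a := by
  rw [integral_armLaw, localMass]
  simp_rw [mul_comm]

/-- The density ratio of the normalised target and the proposal density of an arm. -/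
noncomputable def ratio (a : Fin K) (x : 𝒳) : ℝ := P.target x / P.g a x

theorem integral_f_nonneg : 0 ≤ ∫ x, P.f x ∂P.ν := integral_nonneg P.f_nonneg

theorem integral_f_pos (hα : 0 < α) (hZ : 0 < P.normConst α) : 0 < ∫ x, P.f x ∂P.ν := by
  refine P.integral_f_nonneg.lt_of_ne fun h => ?_
  rw [normConst, ← h, Real.zero_rpow hα.ne'] at hZ
  exact lt_irrefl _ hZ

theorem target_nonneg (x : 𝒳) : 0 ≤ P.target x := div_nonneg (P.f_nonneg x) P.integral_f_nonneg

theorem ratio_nonneg (a : Fin K) (x : 𝒳) : 0 ≤ P.ratio a x :=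
  div_nonneg (P.target_nonneg x) (P.g_nonneg a x)

theorem measurable_target : Measurable P.target := P.measurable_f.div_const _

theorem measurable_ratio (a : Fin K) : Measurable (P.ratio a) :=
  P.measurable_target.div (P.measurable_g a)

theorem ratio_rpow (α : ℝ) (a : Fin K) (x : 𝒳) :
    P.ratio a x ^ α = P.weight α a x / P.normConst α := by
  rw [ratio, target, weight, normConst, div_right_comm,
    Real.div_rpow (div_nonneg (P.f_nonneg x) (P.g_nonneg a x)) P.integral_f_nonneg]

theorem integrable_target : Integrable P.target P.ν := P.integrable_f.div_const _

/-- This is where covering matters: where $g_a = 0$ the quotient is $0$ by convention, and almost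
everywhere so is the target. -/
theorem g_mul_ratio (a : Fin K) :
    (fun x => P.g a x * P.ratio a x) =ᵐ[P.ν.restrict (P.cell a)] P.target := by
  filter_upwards [P.g_covers a] with x hx
  rcases eq_or_ne (P.g a x) 0 with h | h
  · simp [h, target, hx h]
  · simp [ratio, mul_div_cancel₀ _ h]

theorem integrable_ratio (a : Fin K) : Integrable (P.ratio a) (P.armLaw a) := by
  rw [integrable_armLaw_iff]
  exact (integrable_congr (P.g_mul_ratio a)).2 P.integrable_target.integrableOn

theorem sum_integral_ratio (hZ : 0 < ∫ x, P.f x ∂P.ν) :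
    ∑ a, ∫ x, P.ratio a x ∂P.armLaw a = 1 := by
  have h1 : ∫ x, P.target x ∂P.ν = 1 := by
    simp only [target]
    rw [integral_div, div_self hZ.ne']
  rw [← h1, ← setIntegral_univ, ← P.iUnion_cell, integral_iUnion_fintype P.measurableSet_cell
    P.disjoint_cell fun _ => P.integrable_target.integrableOn]
  exact Finset.sum_congr rfl fun a _ => by
    rw [integral_armLaw]
    exact integral_congr_ae (P.g_mul_ratio a)

theorem targetMass_eq_integral (hα : 0 < α) (a : Fin K) :
    P.targetMass α a = ∫ x, P.ratio a x ^ α ∂P.armLaw a := by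
  rw [integral_armLaw, targetMass]
  refine integral_congr_ae ?_
  filter_upwards [P.g_covers a] with x hx
  rcases (P.g_nonneg a x).eq_or_lt with h | h
  · simp [← h, target, hx h.symm, Real.zero_rpow hα.ne']
  · rw [ratio, Real.div_rpow (P.target_nonneg x) h.le, Real.rpow_sub h, Real.rpow_one]
    ring

theorem targetMass_eq (hα : 0 < α) (a : Fin K) :
    P.targetMass α a = P.localMass α a / P.normConst α := by
  rw [targetMass_eq_integral P hα, localMass_eq]
  simp_rw [ratio_rpow]
  rw [integral_div]

theorem optimal_eq (hα : 0 < α) (hZ : 0 < P.normConst α) (hζ : ∀ a, 0 < P.localMass α a)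
    (a : Fin K) :
    P.optimal α a = P.localMass α a ^ (1 / α) / ∑ b, P.localMass α b ^ (1 / α) := by
  simp only [optimal, P.targetMass_eq hα, Real.div_rpow (hζ _).le hZ.le]
  rw [← Finset.sum_div, div_div_div_cancel_right₀ (Real.rpow_pos_of_pos hZ _).ne']

/-- For $\alpha \ne 1$ the loss is an affine combination of the ratio and the weight. At $\alpha =
1$ the logarithm is controlled by the quadratic bound, which costs a second moment of the weight. -/
theorem integrable_alphaLoss_ratio (a : Fin K) (hW : Integrable (P.weight α a) (P.armLaw a))
    (hW2 : Integrable (fun x => P.weight α a x ^ 2) (P.armLaw a)) {w : ℝ} (hw : 0 < w) :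
    Integrable (fun x => alphaLoss α (P.ratio a x / w)) (P.armLaw a) := by
  have hr := P.integrable_ratio a
  by_cases h1 : α = 1
  · subst h1
    have hr2 : Integrable (fun x => P.ratio a x ^ 2) (P.armLaw a) := by
      refine (hW2.div_const (P.normConst 1 ^ 2)).congr (Eventually.of_forall fun x => ?_)
      simp only
      rw [← div_pow, ← ratio_rpow, Real.rpow_one]
    refine Integrable.mono' (g := fun x => 2 * (P.ratio a x / w - 1) ^ 2) ?_
      ((measurable_alphaLoss 1).comp ((P.measurable_ratio a).div_const w)).aestronglyMeasurable ?_
    · have : Integrable (fun x => 2 * (P.ratio a x ^ 2 / w ^ 2 - 2 / w * P.ratio a x + 1))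
          (P.armLaw a) :=
        (((hr2.div_const _).sub (hr.const_mul _)).add (integrable_const 1)).const_mul 2
      refine this.congr (Eventually.of_forall fun x => ?_)
      simp only
      ring
    · refine Eventually.of_forall fun x => ?_
      have h0 : 0 ≤ P.ratio a x / w := div_nonneg (P.ratio_nonneg a x) hw.le
      rw [Real.norm_of_nonneg (alphaLoss_nonneg one_pos h0)]
      refine (alphaLoss_le_sq one_pos one_le_two h0).trans (le_of_eq ?_)
      norm_num
  · simp_rw [alphaLoss_of_ne h1, Real.div_rpow (P.ratio_nonneg a _) hw.le, ratio_rpow]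
    exact ((((hr.div_const _).const_mul _).add (integrable_const _)).sub
      ((hW.div_const _).div_const _)).div_const _

theorem loss_proposal (w : Fin K → ℝ)
    (hint : ∀ a, Integrable (fun x => alphaLoss α (P.ratio a x / w a)) (P.armLaw a)) :
    P.loss α (P.proposal w) = ∑ a, ∫ x, w a * alphaLoss α (P.ratio a x / w a) ∂P.armLaw a := by
  have hcell : ∀ a, ∀ x ∈ P.cell a, alphaLoss α (P.target x / P.proposal w x) * P.proposal w x
      = P.g a x * (w a * alphaLoss α (P.ratio a x / w a)) := by
    intro a x hx
    have hp : P.proposal w x = w a * P.g a x := by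
      rw [proposal, Finset.sum_eq_single a]
      · rw [Set.indicator_of_mem hx]
      · intro b _ hb
        rw [Set.indicator_of_notMem, mul_zero]
        exact fun hxb => Set.disjoint_left.1 (P.disjoint_cell hb) hxb hx
      · simp
    rw [hp, ratio, div_div, mul_comm (P.g a x) (w a)]
    ring
  have hon : ∀ a, IntegrableOn (fun x => alphaLoss α (P.target x / P.proposal w x) *
      P.proposal w x) (P.cell a) P.ν := fun a => by
    rw [integrableOn_congr_fun (hcell a) (P.measurableSet_cell a), ← integrable_armLaw_iff]
    exact (hint a).const_mul _
  rw [loss, ← setIntegral_univ, ← P.iUnion_cell,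
    integral_iUnion_fintype P.measurableSet_cell P.disjoint_cell hon]
  refine Finset.sum_congr rfl fun a _ => ?_
  rw [integral_armLaw]
  exact setIntegral_congr_fun (P.measurableSet_cell a) (hcell a)

/-- This isolates the dependence on $w$: the mean of the ratio does not involve $w$ and cancels in
the regret. -/
theorem integral_alphaLoss_of_ne (hα : 0 < α) (h1 : α ≠ 1) (a : Fin K)
    (hW : Integrable (P.weight α a) (P.armLaw a)) {w : ℝ} (hw : 0 < w) :
    ∫ x, w * alphaLoss α (P.ratio a x / w) ∂P.armLaw a =
      (α * ∫ x, P.ratio a x ∂P.armLaw a + (1 - α) * w - w ^ (1 - α) * P.targetMass α a) /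
        (α * (1 - α)) := by
  have hr := P.integrable_ratio a
  have hrα : Integrable (fun x => P.ratio a x ^ α) (P.armLaw a) := by
    simp_rw [ratio_rpow]
    exact hW.div_const _
  have hpt : ∀ x, w * alphaLoss α (P.ratio a x / w) =
      (α * P.ratio a x + (1 - α) * w - w ^ (1 - α) * P.ratio a x ^ α) / (α * (1 - α)) := by
    intro x
    rw [alphaLoss_of_ne h1, Real.div_rpow (P.ratio_nonneg a _) hw.le, Real.rpow_sub hw,
      Real.rpow_one]
    field_simp
  have e1 : Integrable (fun x => α * P.ratio a x + (1 - α) * w) (P.armLaw a) :=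
    (hr.const_mul _).add (integrable_const _)
  simp_rw [hpt]
  rw [integral_div, integral_sub e1 (hrα.const_mul _),
    integral_add (hr.const_mul _) (integrable_const _), integral_const_mul,
    integral_const_mul (w ^ (1 - α)), targetMass_eq_integral P hα]
  simp

theorem integral_alphaLoss_one (a : Fin K)
    (hint : Integrable (fun x => alphaLoss 1 (P.ratio a x)) (P.armLaw a)) {w : ℝ} (hw : 0 < w) :
    ∫ x, w * alphaLoss 1 (P.ratio a x / w) ∂P.armLaw a =
      ∫ x, alphaLoss 1 (P.ratio a x) ∂P.armLaw a + (w - 1)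
        - Real.log w * ∫ x, P.ratio a x ∂P.armLaw a := by
  have hr := P.integrable_ratio a
  have hpt : ∀ x, w * alphaLoss 1 (P.ratio a x / w) =
      alphaLoss 1 (P.ratio a x) + (w - 1) - Real.log w * P.ratio a x := by
    intro x
    rw [alphaLoss_one, alphaLoss_one, InformationTheory.klFun, InformationTheory.klFun]
    rcases (P.ratio_nonneg a x).eq_or_lt with h | h
    · simp [← h]
    · rw [Real.log_div h.ne' hw.ne']
      field_simp
      ring
  have e1 : Integrable (fun x => alphaLoss 1 (P.ratio a x) + (w - 1)) (P.armLaw a) :=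
    hint.add (integrable_const _)
  simp_rw [hpt]
  rw [integral_sub e1 (hr.const_mul _), integral_add hint (integrable_const _),
    integral_const_mul]
  simp

/-- The regret is a multiple of the `α`-divergence of the cell probabilities from the optimal
ones. -/
theorem regret_eq (hα : 0 < α) (hZ : 0 < P.normConst α) (hζ : ∀ a, 0 < P.localMass α a)
    (hW : ∀ a, Integrable (P.weight α a) (P.armLaw a))
    (hW2 : ∀ a, Integrable (fun x => P.weight α a x ^ 2) (P.armLaw a))
    (w : Fin K → ℝ) (hw : ∀ a, 0 < w a) (hw1 : ∑ a, w a = 1) :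
    P.regret α w = (∑ b, P.targetMass α b ^ (1 / α)) ^ α *
      ∑ a, w a * alphaLoss α (P.optimal α a / w a) := by
  have hm : ∀ a, 0 < P.targetMass α a := fun a => by
    rw [P.targetMass_eq hα]
    exact div_pos (hζ a) hZ
  have hne : (Finset.univ : Finset (Fin K)).Nonempty := by
    by_contra h
    rw [Finset.not_nonempty_iff_eq_empty] at h
    simp [h] at hw1
  set S := ∑ b, P.targetMass α b ^ (1 / α) with hS
  have hSpos : 0 < S := Finset.sum_pos (fun b _ => Real.rpow_pos_of_pos (hm b) _) hne
  have hp : ∀ a, 0 < P.optimal α a := fun a => div_pos (Real.rpow_pos_of_pos (hm a) _) hSpos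
  have hp1 : ∑ a, P.optimal α a = 1 := by
    simp only [optimal]
    rw [← Finset.sum_div, div_self hSpos.ne']
  -- Inverting the definition of the optimal probabilities lets the masses be eliminated; the factor
  -- $S^\alpha$ becomes the scale of the regret.
  have hmp : ∀ a, P.targetMass α a = S ^ α * P.optimal α a ^ α := fun a => by
    rw [← Real.mul_rpow hSpos.le (hp a).le, optimal, mul_div_cancel₀ _ hSpos.ne',
      ← Real.rpow_mul (hm a).le, one_div_mul_cancel hα.ne', Real.rpow_one]
  rw [regret, P.loss_proposal w fun a => P.integrable_alphaLoss_ratio a (hW a) (hW2 a) (hw a),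
    P.loss_proposal _ fun a => P.integrable_alphaLoss_ratio a (hW a) (hW2 a) (hp a)]
  by_cases h1 : α = 1
  · subst h1
    have hint : ∀ a, Integrable (fun x => alphaLoss 1 (P.ratio a x)) (P.armLaw a) := fun a => by
      simpa using P.integrable_alphaLoss_ratio a (hW a) (hW2 a) one_pos
    have hr : ∀ a, ∫ x, P.ratio a x ∂P.armLaw a = P.targetMass 1 a := fun a => by
      simp [P.targetMass_eq_integral one_pos]
    -- At $\alpha = 1$ the masses are the probabilities of the cells under the normalised target.
    have hS1 : S = 1 := by
      rw [hS]
      simpa [hr] using P.sum_integral_ratio (P.integral_f_pos one_pos hZ)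
    have hmp1 : ∀ a, P.targetMass 1 a = P.optimal 1 a := fun a => by
      simpa [hS1] using hmp a
    simp_rw [P.integral_alphaLoss_one _ (hint _) (hw _),
      P.integral_alphaLoss_one _ (hint _) (hp _), hr, hmp1, hS1, Real.one_rpow, one_mul]
    rw [← Finset.sum_sub_distrib]
    refine Finset.sum_congr rfl fun a _ => ?_
    rw [alphaLoss_one, InformationTheory.klFun, Real.log_div (hp a).ne' (hw a).ne']
    field_simp [(hw a).ne']
    ring
  · have h1' : 1 - α ≠ 0 := sub_ne_zero.2 (Ne.symm h1)
    simp_rw [P.integral_alphaLoss_of_ne hα h1 _ (hW _) (hw _),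
      P.integral_alphaLoss_of_ne hα h1 _ (hW _) (hp _)]
    have hterm : ∀ a, w a * alphaLoss α (P.optimal α a / w a) =
        (α * P.optimal α a + (1 - α) * w a - w a ^ (1 - α) * P.optimal α a ^ α) /
          (α * (1 - α)) := fun a => by
      rw [alphaLoss_of_ne h1, Real.div_rpow (hp a).le (hw a).le, Real.rpow_sub (hw a),
        Real.rpow_one]
      have := (hw a).ne'
      field_simp
    have hpp : ∀ a, P.optimal α a ^ (1 - α) * P.targetMass α a = S ^ α * P.optimal α a :=
      fun a => by
        rw [hmp, mul_left_comm, ← Real.rpow_add (hp a), sub_add_cancel, Real.rpow_one]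
    simp_rw [hterm, hpp]
    rw [← Finset.sum_div, ← Finset.sum_div, ← Finset.sum_div, ← sub_div, mul_div_assoc']
    congr 1
    simp_rw [Finset.sum_sub_distrib, Finset.sum_add_distrib, ← Finset.mul_sum, hw1, hp1, hmp,
      mul_left_comm _ (S ^ α), ← Finset.mul_sum]
    ring

end Problem

end Daisee

/-! ### Runs of the algorithm: bookkeeping, measurability and the law of one round. -/

namespace Daisee

variable {K : ℕ} {𝒳 : Type*} [MeasurableSpace 𝒳] (P : Problem K 𝒳) (α : ℝ) (τ : Fin K → ℝ≥0)
  {Ω : Type*} (A : ℕ → Ω → Fin K) (X : ℕ → Ω → 𝒳)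

/-- The number of pulls of an arm along a run. -/
def runPulls (a : Fin K) (t : ℕ) (ω : Ω) : ℕ := pulls (fun l => A l ω) a t

/-- The sum of the weights of the samples from an arm along a run. -/
noncomputable def runSum (a : Fin K) (t : ℕ) (ω : Ω) : ℝ :=
  ∑ l ∈ Finset.Ico 1 t, if A l ω = a then P.weight α a (X l ω) else 0

/-- The estimate of the local mass of an arm along a run. -/
noncomputable def runEstimate (a : Fin K) (t : ℕ) (ω : Ω) : ℝ :=
  P.estimate α (fun l => A l ω) (fun l => X l ω) a t

/-- The optimism boost of an arm along a run. -/
noncomputable def runBoost (a : Fin K) (t : ℕ) (ω : Ω) : ℝ := boost τ (fun l => A l ω) a t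

/-- The optimistic estimate of the local mass of an arm along a run. -/
noncomputable def runScore (a : Fin K) (t : ℕ) (ω : Ω) : ℝ :=
  runEstimate P α A X a t ω + runBoost τ A a t ω

/-- The cell probabilities along a run. -/
noncomputable def runProb (t : ℕ) (a : Fin K) (ω : Ω) : ℝ :=
  P.armProb α τ (fun l => A l ω) (fun l => X l ω) t a

theorem runPulls_eq (a : Fin K) (t : ℕ) (ω : Ω) :
    runPulls A a t ω = ∑ l ∈ Finset.Ico 1 t, if A l ω = a then 1 else 0 := by
  rw [runPulls, pulls, Finset.card_filter]

theorem runPulls_succ (a : Fin K) {t : ℕ} (ht : 1 ≤ t) (ω : Ω) :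
    runPulls A a (t + 1) ω = runPulls A a t ω + if A t ω = a then 1 else 0 := by
  rw [runPulls_eq, runPulls_eq, Finset.sum_Ico_succ_top ht]

theorem runPulls_lt (a : Fin K) {t : ℕ} (ht : 1 ≤ t) (ω : Ω) : runPulls A a t ω < t := by
  have : runPulls A a t ω ≤ t - 1 := by
    rw [runPulls, pulls]
    simpa using Finset.card_filter_le (Finset.Ico 1 t) fun l => A l ω = a
  omega

theorem runSum_succ (a : Fin K) {t : ℕ} (ht : 1 ≤ t) (ω : Ω) :
    runSum P α A X a (t + 1) ω =
      runSum P α A X a t ω + if A t ω = a then P.weight α a (X t ω) else 0 := by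
  rw [runSum, runSum, Finset.sum_Ico_succ_top ht]

theorem runSum_nonneg (a : Fin K) (t : ℕ) (ω : Ω) : 0 ≤ runSum P α A X a t ω :=
  Finset.sum_nonneg fun l _ => by
    split_ifs
    exacts [P.weight_nonneg α a _, le_rfl]

theorem runEstimate_eq (a : Fin K) (t : ℕ) (ω : Ω) :
    runEstimate P α A X a t ω = runSum P α A X a t ω / runPulls A a t ω := by
  rw [runEstimate, Problem.estimate, Finset.sum_filter, runSum, runPulls]

theorem runEstimate_nonneg (a : Fin K) (t : ℕ) (ω : Ω) : 0 ≤ runEstimate P α A X a t ω := by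
  rw [runEstimate_eq]
  exact div_nonneg (runSum_nonneg P α A X a t ω) (Nat.cast_nonneg _)

theorem runBoost_eq (a : Fin K) (t : ℕ) (ω : Ω) : runBoost τ A a t ω =
    boostConst * (τ a : ℝ) * Real.sqrt (Real.log t / runPulls A a t ω) := rfl

theorem boostConst_nonneg : 0 ≤ boostConst := Real.sqrt_nonneg _

/-- The deviation bound is $t^{-c^2/2}$, so this gives the exponent $5$. It follows from $\log_2(2e)
= 1 + 1/\log 2$. -/
theorem ten_le_boostConst_sq : 10 ≤ boostConst ^ 2 := by
  have h2 : 0 < Real.log 2 := Real.log_pos one_lt_two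
  have hl : Real.logb 2 (2 * Real.exp 1) = 1 + 1 / Real.log 2 := by
    rw [Real.logb, Real.log_mul two_ne_zero (Real.exp_pos 1).ne', Real.log_exp]
    field_simp
  have h3 : 1.4425 ≤ 1 / Real.log 2 := by
    rw [le_div_iff₀ h2]
    linarith [Real.log_two_lt_d9]
  rw [boostConst, Real.sq_sqrt] <;> rw [hl] <;> linarith

theorem boostConst_pos : 0 < boostConst :=
  boostConst_nonneg.lt_of_ne fun h => by
    have := ten_le_boostConst_sq
    rw [← h] at this
    norm_num at this

theorem runBoost_nonneg (a : Fin K) (t : ℕ) (ω : Ω) : 0 ≤ runBoost τ A a t ω := by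
  rw [runBoost_eq]
  exact mul_nonneg (mul_nonneg boostConst_nonneg (τ a).2) (Real.sqrt_nonneg _)

theorem runScore_nonneg (a : Fin K) (t : ℕ) (ω : Ω) : 0 ≤ runScore P α τ A X a t ω :=
  add_nonneg (runEstimate_nonneg P α A X a t ω) (runBoost_nonneg τ A a t ω)

theorem runProb_of_lt {t : ℕ} (ht : K < t) (a : Fin K) (ω : Ω) :
    runProb P α τ A X t a ω = runScore P α τ A X a t ω ^ (1 / α) /
      ∑ b, runScore P α τ A X b t ω ^ (1 / α) := by
  rw [runProb, Problem.armProb, if_neg (not_le.2 ht)]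
  rfl

theorem runProb_of_le {t : ℕ} (ht : t ≤ K) (a : Fin K) (ω : Ω) :
    runProb P α τ A X t a ω = if (a : ℕ) + 1 = t then 1 else 0 := by
  rw [runProb, Problem.armProb, if_pos ht]

theorem runProb_nonneg (t : ℕ) (a : Fin K) (ω : Ω) : 0 ≤ runProb P α τ A X t a ω := by
  rcases le_or_gt t K with ht | ht
  · rw [runProb_of_le P α τ A X ht]
    split_ifs <;> norm_num
  · rw [runProb_of_lt P α τ A X ht]
    exact div_nonneg (Real.rpow_nonneg (runScore_nonneg P α τ A X a t ω) _)
      (Finset.sum_nonneg fun b _ => Real.rpow_nonneg (runScore_nonneg P α τ A X b t ω) _)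

theorem runProb_le_one (t : ℕ) (a : Fin K) (ω : Ω) : runProb P α τ A X t a ω ≤ 1 := by
  rcases le_or_gt t K with ht | ht
  · rw [runProb_of_le P α τ A X ht]
    split_ifs <;> norm_num
  · rw [runProb_of_lt P α τ A X ht]
    have h : ∀ b, 0 ≤ runScore P α τ A X b t ω ^ (1 / α) := fun b =>
      Real.rpow_nonneg (runScore_nonneg P α τ A X b t ω) _
    exact div_le_one_of_le₀ (Finset.single_le_sum (fun b _ => h b) (Finset.mem_univ a))
      (Finset.sum_nonneg fun b _ => h b)

section Measurability

theorem measurable_pair_past {t l : ℕ} (hl : l ∈ Finset.Ico 1 t) :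
    Measurable[past A X t] fun ω => (A l ω, X l ω) :=
  Measurable.mono (comap_measurable _) (le_iSup₂_of_le l hl le_rfl) le_rfl

theorem measurable_arm_past {t l : ℕ} (hl : l ∈ Finset.Ico 1 t) : Measurable[past A X t] (A l) :=
  measurable_fst.comp (measurable_pair_past A X hl)

theorem measurable_sample_past {t l : ℕ} (hl : l ∈ Finset.Ico 1 t) :
    Measurable[past A X t] (X l) :=
  measurable_snd.comp (measurable_pair_past A X hl)

theorem measurable_runPulls (a : Fin K) (t : ℕ) : Measurable[past A X t] (runPulls A a t) := by
  simp only [funext (runPulls_eq A a t)]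
  refine Finset.measurable_fun_sum (m := past A X t) _ fun l hl => ?_
  exact Measurable.ite (measurable_arm_past A X hl (measurableSet_singleton a))
    measurable_const measurable_const

theorem measurable_runSum (a : Fin K) (t : ℕ) : Measurable[past A X t] (runSum P α A X a t) := by
  unfold runSum
  refine Finset.measurable_fun_sum (m := past A X t) _ fun l hl => ?_
  exact Measurable.ite (measurable_arm_past A X hl (measurableSet_singleton a))
    ((P.measurable_weight α a).comp (measurable_sample_past A X hl)) measurable_const

theorem measurable_runPulls_cast (a : Fin K) (t : ℕ) :
    Measurable[past A X t] fun ω => (runPulls A a t ω : ℝ) :=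
  (measurable_of_countable (Nat.cast : ℕ → ℝ)).comp (measurable_runPulls A X a t)

theorem measurable_runEstimate (a : Fin K) (t : ℕ) :
    Measurable[past A X t] (runEstimate P α A X a t) := by
  simp only [funext (runEstimate_eq P α A X a t)]
  exact (measurable_runSum P α A X a t).div (measurable_runPulls_cast A X a t)

theorem measurable_runBoost (a : Fin K) (t : ℕ) : Measurable[past A X t] (runBoost τ A a t) := by
  simp only [funext (runBoost_eq τ A a t)]
  exact (((measurable_runPulls_cast A X a t).const_div _).sqrt).const_mul _

theorem measurable_runScore (a : Fin K) (t : ℕ) :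
    Measurable[past A X t] (runScore P α τ A X a t) :=
  (measurable_runEstimate P α A X a t).add (measurable_runBoost τ A X a t)

theorem measurable_runProb (t : ℕ) (a : Fin K) :
    Measurable[past A X t] (runProb P α τ A X t a) := by
  rcases le_or_gt t K with ht | ht
  · simp only [funext (runProb_of_le P α τ A X ht a)]
    exact measurable_const
  · simp only [funext (runProb_of_lt P α τ A X ht a)]
    exact ((measurable_runScore P α τ A X a t).pow_const _).div
      (Finset.measurable_fun_sum (m := past A X t) _
        fun b _ => (measurable_runScore P α τ A X b t).pow_const _)

end Measurability

namespace IsRun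

variable {P α τ A X} [MeasurableSpace Ω] {μ : Measure Ω} (h : IsRun P α τ μ A X)
include h

theorem past_le (t : ℕ) : past A X t ≤ ‹MeasurableSpace Ω› :=
  iSup₂_le fun l _ => ((h.measurable_arm l).prodMk (h.measurable_sample l)).comap_le

theorem measurableSet_arm (t : ℕ) (a : Fin K) : MeasurableSet {ω | A t ω = a} :=
  h.measurable_arm t (measurableSet_singleton a)

theorem measure_step [IsProbabilityMeasure μ] {t : ℕ} (ht : 1 ≤ t) (a : Fin K) {B : Set 𝒳}
    (hB : MeasurableSet B) {E : Set Ω} (hE : MeasurableSet[past A X t] E) :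
    μ (X t ⁻¹' B ∩ ({ω | A t ω = a} ∩ E)) =
      (∫⁻ ω in E, ENNReal.ofReal (runProb P α τ A X t a ω) ∂μ) * P.armLaw a B := by
  have hm := h.past_le t
  have hS : MeasurableSet {ω | A t ω = a ∧ X t ω ∈ B} :=
    (h.measurableSet_arm t a).inter (h.measurable_sample t hB)
  have hq : Measurable (runProb P α τ A X t a) := (measurable_runProb P α τ A X t a).mono hm le_rfl
  have hqi : Integrable (runProb P α τ A X t a) (μ.restrict E) :=
    Integrable.of_bound hq.aestronglyMeasurable 1 (Eventually.of_forall fun ω => by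
      rw [Real.norm_of_nonneg (runProb_nonneg P α τ A X t a ω)]
      exact runProb_le_one P α τ A X t a ω)
  have h1 := setIntegral_condExp hm (f := {ω | A t ω = a ∧ X t ω ∈ B}.indicator fun _ => (1 : ℝ))
    ((integrable_const _).indicator hS) hE (μ := μ)
  rw [setIntegral_congr_ae (g := fun ω => runProb P α τ A X t a ω * (P.armLaw a).real B)
    (hm _ hE) ((h.step t ht a B hB).mono fun ω hω _ => hω), integral_mul_const,
    integral_indicator_const _ hS, smul_eq_mul, mul_one, measureReal_restrict_apply hS] at h1
  have hset : X t ⁻¹' B ∩ ({ω | A t ω = a} ∩ E) = {ω | A t ω = a ∧ X t ω ∈ B} ∩ E := by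
    ext ω
    simp only [Set.mem_inter_iff, Set.mem_preimage, Set.mem_ofPred_eq]
    tauto
  rw [hset, ← ofReal_measureReal, ← h1, ENNReal.ofReal_mul (integral_nonneg
    fun ω => runProb_nonneg P α τ A X t a ω), ofReal_integral_eq_lintegral_ofReal hqi
    (Eventually.of_forall fun ω => runProb_nonneg P α τ A X t a ω), ofReal_measureReal]

theorem setLIntegral_step [IsProbabilityMeasure μ] {t : ℕ} (ht : 1 ≤ t) (a : Fin K)
    {k : 𝒳 → ℝ≥0∞} (hk : Measurable k) {E : Set Ω} (hE : MeasurableSet[past A X t] E) :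
    ∫⁻ ω in E, {ω | A t ω = a}.indicator (fun ω => k (X t ω)) ω ∂μ =
      (∫⁻ ω in E, ENNReal.ofReal (runProb P α τ A X t a ω) ∂μ) * ∫⁻ x, k x ∂P.armLaw a := by
  have hX := h.measurable_sample t
  have hlaw : (μ.restrict ({ω | A t ω = a} ∩ E)).map (X t) =
      (∫⁻ ω in E, ENNReal.ofReal (runProb P α τ A X t a ω) ∂μ) • P.armLaw a := by
    ext B hB
    rw [Measure.map_apply hX hB, Measure.restrict_apply (hX hB), h.measure_step ht a hB hE,
      Measure.smul_apply, smul_eq_mul]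
  rw [lintegral_indicator (h.measurableSet_arm t a), Measure.restrict_restrict
    (h.measurableSet_arm t a), ← lintegral_map hk hX, hlaw, lintegral_smul_measure, smul_eq_mul]

/-- Given the past, the arm of round `t` has law `runProb`, and the sample has the law of
the arm. -/
theorem lintegral_step [IsProbabilityMeasure μ] {t : ℕ} (ht : 1 ≤ t) (a : Fin K)
    {k : 𝒳 → ℝ≥0∞} (hk : Measurable k) {G : Ω → ℝ≥0∞} (hG : Measurable[past A X t] G) :
    ∫⁻ ω, {ω | A t ω = a}.indicator (fun ω => k (X t ω)) ω * G ω ∂μ =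
      (∫⁻ ω, ENNReal.ofReal (runProb P α τ A X t a ω) * G ω ∂μ) * ∫⁻ x, k x ∂P.armLaw a := by
  have hm := h.past_le t
  have hI : Measurable ({ω | A t ω = a}.indicator fun ω => k (X t ω)) :=
    (hk.comp (h.measurable_sample t)).indicator (h.measurableSet_arm t a)
  have hq : Measurable fun ω => ENNReal.ofReal (runProb P α τ A X t a ω) :=
    ((measurable_runProb P α τ A X t a).mono hm le_rfl).ennreal_ofReal
  have hG' : Measurable G := hG.mono hm le_rfl
  -- Two measures on the past $\sigma$-algebra that agree on past events give every past-measurable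
  -- $G$ the same integral, so no approximation of $G$ is needed.
  have heq : (μ.withDensity ({ω | A t ω = a}.indicator fun ω => k (X t ω))).trim hm =
      ((∫⁻ x, k x ∂P.armLaw a) •
        μ.withDensity fun ω => ENNReal.ofReal (runProb P α τ A X t a ω)).trim hm := by
    refine @Measure.ext _ (past A X t) _ _ fun E hE => ?_
    rw [trim_measurableSet_eq hm hE, trim_measurableSet_eq hm hE, withDensity_apply _ (hm _ hE),
      Measure.smul_apply, withDensity_apply _ (hm _ hE), h.setLIntegral_step ht a hk hE,
      smul_eq_mul, mul_comm]
  have := congrArg (fun ν => @lintegral _ (past A X t) ν G) heq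
  rw [lintegral_trim hm hG, lintegral_trim hm hG, lintegral_smul_measure,
    lintegral_withDensity_eq_lintegral_mul _ hI hG',
    lintegral_withDensity_eq_lintegral_mul _ hq hG', smul_eq_mul, mul_comm (lintegral _ _)] at this
  exact this

theorem lintegral_arm_mul [IsProbabilityMeasure μ] {t : ℕ} (ht : 1 ≤ t) (a : Fin K)
    {G : Ω → ℝ≥0∞} (hG : Measurable[past A X t] G) :
    ∫⁻ ω, {ω | A t ω = a}.indicator 1 ω * G ω ∂μ =
      ∫⁻ ω, ENNReal.ofReal (runProb P α τ A X t a ω) * G ω ∂μ := by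
  have := h.lintegral_step ht a (k := fun _ => 1) measurable_const hG
  rw [lintegral_const, measure_univ, mul_one, mul_one] at this
  exact this

theorem lintegral_step' [IsProbabilityMeasure μ] {t : ℕ} (ht : 1 ≤ t) (a : Fin K)
    {k : 𝒳 → ℝ≥0∞} (hk : Measurable k) {G : Ω → ℝ≥0∞} (hG : Measurable[past A X t] G) :
    ∫⁻ ω, {ω | A t ω = a}.indicator (fun ω => k (X t ω)) ω * G ω ∂μ =
      (∫⁻ ω, {ω | A t ω = a}.indicator 1 ω * G ω ∂μ) * ∫⁻ x, k x ∂P.armLaw a := by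
  rw [h.lintegral_step ht a hk hG, h.lintegral_arm_mul ht a hG]

/-- Arms are numbered from $0$ and rounds from $1$, so arm $a$ is almost surely drawn in the initial
round $a + 1 \le K$. -/
theorem ae_one_le_runPulls [IsProbabilityMeasure μ] {t : ℕ} (ht : K < t) (a : Fin K) :
    ∀ᵐ ω ∂μ, 1 ≤ runPulls A a t ω := by
  have ha : (a : ℕ) + 1 ≤ K := a.2
  have h1 : ∫⁻ ω, {ω | A (a + 1) ω = a}.indicator 1 ω ∂μ = 1 := by
    have := h.lintegral_arm_mul (t := a + 1) (by omega) a (G := fun _ => 1)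
      measurable_const
    simpa [runProb_of_le P α τ A X ha] using this
  have h2 : ∀ᵐ ω ∂μ, A (a + 1) ω = a := by
    rw [lintegral_indicator_one (h.measurableSet_arm _ a)] at h1
    exact (prob_compl_eq_zero_iff (h.measurableSet_arm _ a)).2 h1
  filter_upwards [h2] with ω hω
  rw [runPulls, pulls, Nat.one_le_iff_ne_zero, Finset.card_ne_zero]
  exact ⟨a + 1, by simp [hω]; omega⟩

end IsRun

end Daisee

/-! ### Concentration of the estimates. -/

namespace Daisee

variable {K : ℕ} {𝒳 : Type*} [MeasurableSpace 𝒳] {P : Problem K 𝒳} {α : ℝ} {τ : Fin K → ℝ≥0}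

namespace Problem

theorem SubGaussianWeights.lintegral_exp_le (hsub : P.SubGaussianWeights α τ) (a : Fin K)
    (θ : ℝ) :
    ∫⁻ x, ENNReal.ofReal (Real.exp (θ * (P.weight α a x - P.localMass α a)
      - θ ^ 2 * (τ a : ℝ) ^ 2 / 2)) ∂P.armLaw a ≤ 1 := by
  have hs := hsub a
  rw [← P.localMass_eq] at hs
  have h1 := hs.mgf_le θ
  simp_rw [Real.exp_sub]
  rw [← ofReal_integral_eq_lintegral_ofReal ((hs.integrable_exp_mul θ).div_const _)
    (Eventually.of_forall fun x => by positivity), integral_div, ENNReal.ofReal_le_one,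
    div_le_one (Real.exp_pos _)]
  refine h1.trans (le_of_eq ?_)
  push_cast
  ring_nf

theorem SubGaussianWeights.memLp_weight (hsub : P.SubGaussianWeights α τ) (a : Fin K) :
    MemLp (P.weight α a) 2 (P.armLaw a) := by
  have h1 : MemLp (fun _ : 𝒳 => ∫ y, P.weight α a y ∂P.armLaw a) 2 (P.armLaw a) := memLp_const _
  refine (((hsub a).memLp 2).add h1).ae_eq (Eventually.of_forall fun x => ?_)
  simp

theorem SubGaussianWeights.integrable_weight (hsub : P.SubGaussianWeights α τ) (a : Fin K) :
    Integrable (P.weight α a) (P.armLaw a) :=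
  (hsub.memLp_weight a).integrable one_le_two

theorem SubGaussianWeights.integrable_weight_sq (hsub : P.SubGaussianWeights α τ) (a : Fin K) :
    Integrable (fun x => P.weight α a x ^ 2) (P.armLaw a) :=
  (hsub.memLp_weight a).integrable_sq

theorem SubGaussianWeights.weight_ae_eq (hsub : P.SubGaussianWeights α τ) {a : Fin K}
    (ha : τ a = 0) : ∀ᵐ x ∂P.armLaw a, P.weight α a x = P.localMass α a := by
  have hs := hsub a
  rw [ha, zero_pow two_ne_zero, ← P.localMass_eq] at hs
  filter_upwards [hs.ae_eq_zero_of_hasSubgaussianMGF_zero] with x hx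
  simpa [sub_eq_zero] using hx

/-- The second moment of a weight is bounded in terms of its mean and its variance factor. -/
theorem SubGaussianWeights.lintegral_weight_sq_le (hsub : P.SubGaussianWeights α τ) (a : Fin K) :
    ∫⁻ x, ENNReal.ofReal (P.weight α a x ^ 2) ∂P.armLaw a ≤
      ENNReal.ofReal (8 * Real.exp ((τ a : ℝ) ^ 2 / 2) + 2 * P.localMass α a ^ 2) := by
  have hs := hsub a
  rw [← P.localMass_eq] at hs
  set V := fun x => P.weight α a x - P.localMass α a with hV
  have i1 := hs.integrable_exp_mul 1
  have i2 := hs.integrable_exp_mul (-1)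
  have m1 := hs.mgf_le 1
  have m2 := hs.mgf_le (-1)
  rw [mgf] at m1 m2
  push_cast at m1 m2
  have hpt : ∀ x, P.weight α a x ^ 2 ≤ 4 * (Real.exp (1 * V x) + Real.exp (-1 * V x)) +
      2 * P.localMass α a ^ 2 := fun x => by
    have hV2 : V x ^ 2 ≤ 2 * (Real.exp (1 * V x) + Real.exp (-1 * V x)) := by
      have e1 : ∀ y : ℝ, 0 ≤ y → y ^ 2 ≤ 2 * Real.exp y := fun y hy => by
        have := Real.quadratic_le_exp_of_nonneg hy
        nlinarith
      rcases le_total 0 (V x) with h0 | h0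
      · have := e1 _ h0
        rw [one_mul]
        linarith [Real.exp_pos (-1 * V x)]
      · have := e1 (-V x) (by linarith)
        rw [neg_one_mul, neg_sq] at *
        linarith [Real.exp_pos (1 * V x)]
    have : P.weight α a x = V x + P.localMass α a := by simp [hV]
    rw [this]
    nlinarith [sq_nonneg (V x - P.localMass α a)]
  have i3 : Integrable (fun x => 4 * (Real.exp (1 * V x) + Real.exp (-1 * V x)))
      (P.armLaw a) := (i1.add i2).const_mul 4
  rw [← ofReal_integral_eq_lintegral_ofReal (hsub.integrable_weight_sq a)
    (Eventually.of_forall fun x => sq_nonneg _)]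
  refine ENNReal.ofReal_le_ofReal ?_
  refine (integral_mono (hsub.integrable_weight_sq a) (i3.add (integrable_const _)) hpt).trans ?_
  simp only [Pi.add_apply]
  rw [integral_add i3 (integrable_const _), integral_const_mul, integral_add i1 i2]
  simp only [integral_const, probReal_univ, one_smul]
  norm_num at m1 m2 ⊢
  linarith

end Problem

namespace IsRun

variable {Ω : Type*} [MeasurableSpace Ω] {A : ℕ → Ω → Fin K} {X : ℕ → Ω → 𝒳} {μ : Measure Ω}
  [IsProbabilityMeasure μ] (h : IsRun P α τ μ A X)
include h

/-- The integrand is a supermartingale started at $1$: it changes only in rounds that choose arm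
$a$, by a factor depending on the fresh sample whose mean is at most $1$ by sub-Gaussianity. No
independence of the pull counts is required. -/
theorem lintegral_exp_le_one (hsub : P.SubGaussianWeights α τ) (a : Fin K) (θ : ℝ) {t : ℕ}
    (ht : 1 ≤ t) :
    ∫⁻ ω, ENNReal.ofReal (Real.exp (θ * (runSum P α A X a t ω
      - P.localMass α a * runPulls A a t ω)
      - θ ^ 2 * (τ a : ℝ) ^ 2 / 2 * runPulls A a t ω)) ∂μ ≤ 1 := by
  set U : ℕ → Ω → ℝ≥0∞ := fun t ω => ENNReal.ofReal (Real.exp (θ * (runSum P α A X a t ω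
      - P.localMass α a * runPulls A a t ω)
      - θ ^ 2 * (τ a : ℝ) ^ 2 / 2 * runPulls A a t ω)) with hU
  change ∫⁻ ω, U t ω ∂μ ≤ 1
  have hUm : ∀ t, Measurable[past A X t] (U t) := fun t =>
    ((((measurable_runSum P α A X a t).sub
      ((measurable_runPulls_cast A X a t).const_mul _)).const_mul θ).sub
      ((measurable_runPulls_cast A X a t).const_mul _)).exp.ennreal_ofReal
  induction t, ht using Nat.le_induction with
  | base => simp [hU, runSum, runPulls_eq]
  | succ t ht ih =>
    set k : 𝒳 → ℝ≥0∞ := fun x => ENNReal.ofReal (Real.exp (θ * (P.weight α a x -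
      P.localMass α a) - θ ^ 2 * (τ a : ℝ) ^ 2 / 2)) with hk
    have hkm : Measurable k :=
      ((((P.measurable_weight α a).sub_const _).const_mul θ).sub_const _).exp.ennreal_ofReal
    have hS := h.measurableSet_arm t a
    have hU' := (hUm t).mono (h.past_le t) le_rfl
    have hR : Measurable fun ω => {ω | A t ω = a}ᶜ.indicator 1 ω * U t ω :=
      (measurable_one.indicator hS.compl).mul hU'
    have hrec : ∀ ω, U (t + 1) ω = {ω | A t ω = a}.indicator (fun ω => k (X t ω)) ω * U t ω +
        {ω | A t ω = a}ᶜ.indicator 1 ω * U t ω := fun ω => by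
      simp only [hU, hk, runSum_succ P α A X a ht, runPulls_succ A a ht]
      by_cases hω : A t ω = a
      · simp only [hω, if_true, Set.indicator_apply, Set.mem_ofPred_eq, Set.mem_compl_iff,
          not_true_eq_false, if_false, zero_mul, add_zero]
        rw [← ENNReal.ofReal_mul (Real.exp_pos _).le, ← Real.exp_add]
        push_cast
        ring_nf
      · simp [hω]
    calc ∫⁻ ω, U (t + 1) ω ∂μ
        = ∫⁻ ω, {ω | A t ω = a}.indicator (fun ω => k (X t ω)) ω * U t ω ∂μ +
          ∫⁻ ω, {ω | A t ω = a}ᶜ.indicator 1 ω * U t ω ∂μ := by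
          simp_rw [hrec]
          exact lintegral_add_right _ hR
      _ ≤ ∫⁻ ω, {ω | A t ω = a}.indicator 1 ω * U t ω ∂μ +
          ∫⁻ ω, {ω | A t ω = a}ᶜ.indicator 1 ω * U t ω ∂μ := by
          refine add_le_add ?_ le_rfl
          rw [h.lintegral_step' ht a hkm (hUm t)]
          exact mul_le_of_le_one_right' (hsub.lintegral_exp_le a θ)
      _ = ∫⁻ ω, U t ω ∂μ := by
          rw [← lintegral_add_right _ hR]
          refine lintegral_congr fun ω => ?_
          rw [← add_mul]
          by_cases hω : A t ω = a <;> simp [hω]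
      _ ≤ 1 := ih

/-- Chernoff's bound with the number of pulls frozen at $n$, which makes the boost deterministic; $s
= \pm 1$ selects the tail. -/
theorem measure_pulls_eq_deviation_le (hsub : P.SubGaussianWeights α τ) {a : Fin K}
    (ha : 0 < τ a) {t n : ℕ} (ht : 1 ≤ t) (hn : 1 ≤ n) {s : ℝ} (hs : s ^ 2 = 1) :
    μ {ω | runPulls A a t ω = n ∧
      runBoost τ A a t ω ≤ s * (runEstimate P α A X a t ω - P.localMass α a)} ≤
      ENNReal.ofReal (((t : ℝ) ^ 5)⁻¹) := by
  have hn0 : (0 : ℝ) < n := by exact_mod_cast hn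
  have ht0 : (0 : ℝ) < t := by exact_mod_cast ht
  have hτ : (0 : ℝ) < τ a := ha
  have hlog : 0 ≤ Real.log t := Real.log_nonneg (by exact_mod_cast ht)
  set σ : ℝ := boostConst * (τ a : ℝ) * Real.sqrt (Real.log t / n) with hσ
  have hσ0 : 0 ≤ σ := mul_nonneg (mul_nonneg boostConst_nonneg hτ.le) (Real.sqrt_nonneg _)
  have hσ2 : σ ^ 2 * n = boostConst ^ 2 * (τ a : ℝ) ^ 2 * Real.log t := by
    rw [hσ, mul_pow, mul_pow, Real.sq_sqrt (by positivity)]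
    field_simp
  -- The optimal Chernoff parameter: the exponent becomes at least $\sigma^2 n / (2 \tau_a^2) =
  -- \tfrac12 c^2 \log t \ge 5 \log t$.
  set θ : ℝ := s * σ / (τ a : ℝ) ^ 2 with hθ
  have hU := h.lintegral_exp_le_one hsub a θ ht
  have hpt : ∀ ω ∈ {ω | runPulls A a t ω = n ∧
      runBoost τ A a t ω ≤ s * (runEstimate P α A X a t ω - P.localMass α a)},
      ENNReal.ofReal ((t : ℝ) ^ 5) ≤ ENNReal.ofReal (Real.exp (θ * (runSum P α A X a t ω
      - P.localMass α a * runPulls A a t ω)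
      - θ ^ 2 * (τ a : ℝ) ^ 2 / 2 * runPulls A a t ω)) := by
    rintro ω ⟨h1, h2⟩
    refine ENNReal.ofReal_le_ofReal ?_
    rw [runBoost_eq, runEstimate_eq, h1, ← hσ] at h2
    rw [h1]
    have h3 : σ * n ≤ s * (runSum P α A X a t ω - P.localMass α a * n) := by
      calc σ * n ≤ s * (runSum P α A X a t ω / n - P.localMass α a) * n := by gcongr
        _ = _ := by field_simp
    have h4 : σ ^ 2 * n / (τ a : ℝ) ^ 2 ≤ θ * (runSum P α A X a t ω - P.localMass α a * n) := by
      calc σ ^ 2 * n / (τ a : ℝ) ^ 2 = σ / (τ a : ℝ) ^ 2 * (σ * n) := by ring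
        _ ≤ σ / (τ a : ℝ) ^ 2 * (s * (runSum P α A X a t ω - P.localMass α a * n)) := by gcongr
        _ = _ := by rw [hθ]; ring
    have h5 : θ ^ 2 * (τ a : ℝ) ^ 2 / 2 * n = σ ^ 2 * n / (τ a : ℝ) ^ 2 / 2 := by
      rw [hθ, div_pow, mul_pow, hs]
      field_simp
    have h6 : σ ^ 2 * n / (τ a : ℝ) ^ 2 = boostConst ^ 2 * Real.log t := by
      rw [hσ2]
      field_simp
    calc (t : ℝ) ^ 5 = Real.exp (5 * Real.log t) := by
          rw [mul_comm, Real.exp_mul, Real.exp_log ht0]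
          norm_cast
      _ ≤ _ := by
          refine Real.exp_le_exp.2 ?_
          rw [h5]
          nlinarith [ten_le_boostConst_sq]
  have hM := (mul_meas_ge_le_lintegral₀ (μ := μ) (f := fun ω => ENNReal.ofReal (Real.exp (θ *
      (runSum P α A X a t ω - P.localMass α a * runPulls A a t ω)
      - θ ^ 2 * (τ a : ℝ) ^ 2 / 2 * runPulls A a t ω))) ?_ (ENNReal.ofReal ((t : ℝ) ^ 5))).trans hU
  · have h7 := (mul_le_mul_right (measure_mono hpt) (ENNReal.ofReal ((t : ℝ) ^ 5))).trans hM
    rw [ENNReal.ofReal_inv_of_pos (by positivity), ENNReal.le_inv_iff_mul_le, mul_comm]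
    exact h7
  · refine Measurable.aemeasurable ?_
    have m1 := (measurable_runSum P α A X a t).mono (h.past_le t) le_rfl
    have m2 := (measurable_runPulls_cast A X a t).mono (h.past_le t) le_rfl
    exact (((m1.sub (m2.const_mul _)).const_mul θ).sub (m2.const_mul _)).exp.ennreal_ofReal

theorem ae_weight_eq (hsub : P.SubGaussianWeights α τ) {a : Fin K} (ha : τ a = 0) {t : ℕ}
    (ht : 1 ≤ t) : ∀ᵐ ω ∂μ, A t ω = a → P.weight α a (X t ω) = P.localMass α a := by
  have hB : MeasurableSet {x | P.weight α a x ≠ P.localMass α a} :=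
    (P.measurable_weight α a (measurableSet_singleton _)).compl
  have h1 := h.measure_step ht a hB MeasurableSet.univ
  have h2 : P.armLaw a {x | P.weight α a x ≠ P.localMass α a} = 0 :=
    hsub.weight_ae_eq ha
  rw [h2, mul_zero] at h1
  rw [ae_iff]
  convert h1 using 2
  ext ω
  simp [and_comm]

theorem ae_estimate_eq (hsub : P.SubGaussianWeights α τ) {a : Fin K} (ha : τ a = 0) {t : ℕ}
    (ht : K < t) : ∀ᵐ ω ∂μ, runEstimate P α A X a t ω = P.localMass α a := by
  have h1 : ∀ᵐ ω ∂μ, ∀ l, 1 ≤ l → A l ω = a → P.weight α a (X l ω) = P.localMass α a := by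
    rw [ae_all_iff]
    intro l
    by_cases hl : 1 ≤ l
    · filter_upwards [h.ae_weight_eq hsub ha hl] with ω hω _ using hω
    · exact Eventually.of_forall fun ω hl' => absurd hl' hl
  filter_upwards [h1, h.ae_one_le_runPulls ht a] with ω hω hN
  have hN0 : (runPulls A a t ω : ℝ) ≠ 0 := by
    have : 0 < runPulls A a t ω := hN
    positivity
  rw [runEstimate_eq, div_eq_iff hN0, runSum, runPulls_eq]
  push_cast
  rw [Finset.mul_sum]
  refine Finset.sum_congr rfl fun l hl => ?_
  split_ifs with hA
  · rw [mul_one, hω l (Finset.mem_Ico.1 hl).1 hA]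
  · rw [mul_zero]

end IsRun

/-- The event that all estimates of a round are within the optimism boosts. -/
def accurate {Ω : Type*} (P : Problem K 𝒳) (α : ℝ) (τ : Fin K → ℝ≥0) (A : ℕ → Ω → Fin K)
    (X : ℕ → Ω → 𝒳) (t : ℕ) : Set Ω :=
  {ω | ∀ a, |runEstimate P α A X a t ω - P.localMass α a| ≤ runBoost τ A a t ω}

theorem measurableSet_accurate {Ω : Type*} (P : Problem K 𝒳) (α : ℝ) (τ : Fin K → ℝ≥0)
    (A : ℕ → Ω → Fin K) (X : ℕ → Ω → 𝒳) (t : ℕ) :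
    MeasurableSet[past A X t] (accurate P α τ A X t) := by
  have : accurate P α τ A X t = ⋂ a, {ω | |runEstimate P α A X a t ω - P.localMass α a| ≤
      runBoost τ A a t ω} := by
    ext ω
    simp [accurate]
  rw [this]
  refine MeasurableSet.iInter fun a => ?_
  have habs : Measurable[past A X t] fun ω => |runEstimate P α A X a t ω - P.localMass α a| :=
    continuous_abs.measurable.comp ((measurable_runEstimate P α A X a t).sub_const _)
  exact measurableSet_le (mδ := past A X t) habs (measurable_runBoost τ A X a t)

namespace IsRun

variable {Ω : Type*} [MeasurableSpace Ω] {A : ℕ → Ω → Fin K} {X : ℕ → Ω → 𝒳} {μ : Measure Ω}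
  [IsProbabilityMeasure μ] (h : IsRun P α τ μ A X)
include h

/-- The number of pulls is random, so sum over its fewer than $t$ possible values and both tails,
each contributing $t^{-5}$. For $\tau_a = 0$ the Chernoff parameter is unavailable, but the estimate
is almost surely exact. -/
theorem measure_deviation_le (hsub : P.SubGaussianWeights α τ) (a : Fin K) {t : ℕ}
    (ht : K < t) :
    μ {ω | runBoost τ A a t ω < |runEstimate P α A X a t ω - P.localMass α a|} ≤
      ENNReal.ofReal (2 / (t : ℝ) ^ 4) := by
  have ht1 : 1 ≤ t := by omega
  have ht0 : (0 : ℝ) < t := by exact_mod_cast ht1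
  by_cases ha : τ a = 0
  · refine le_of_eq_of_le (measure_mono_null (fun ω hω => ?_)
      (ae_iff.1 (h.ae_estimate_eq hsub ha ht))) zero_le
    intro heq
    have hω' : runBoost τ A a t ω < |runEstimate P α A X a t ω - P.localMass α a| := hω
    rw [heq, sub_self, abs_zero] at hω'
    exact absurd (runBoost_nonneg τ A a t ω) (not_le.2 hω')
  · set E : ℝ → ℕ → Set Ω := fun s n => {ω | runPulls A a t ω = n ∧
      runBoost τ A a t ω ≤ s * (runEstimate P α A X a t ω - P.localMass α a)} with hE
    have hsubset : {ω | runBoost τ A a t ω < |runEstimate P α A X a t ω - P.localMass α a|} ≤ᵐ[μ]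
        ⋃ n ∈ Finset.Ico 1 t, (E 1 n ∪ E (-1) n) := by
      filter_upwards [h.ae_one_le_runPulls ht a] with ω hN hω
      refine Set.mem_iUnion₂.2 ⟨runPulls A a t ω,
        Finset.mem_Ico.2 ⟨hN, runPulls_lt A a ht1 ω⟩, ?_⟩
      rcases abs_choice (runEstimate P α A X a t ω - P.localMass α a) with hc | hc
      · refine Or.inl ⟨rfl, ?_⟩
        rw [one_mul, ← hc]
        exact le_of_lt hω
      · refine Or.inr ⟨rfl, ?_⟩
        rw [neg_one_mul, ← hc]
        exact le_of_lt hω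
    calc _ ≤ μ (⋃ n ∈ Finset.Ico 1 t, (E 1 n ∪ E (-1) n)) := measure_mono_ae hsubset
      _ ≤ ∑ n ∈ Finset.Ico 1 t, μ (E 1 n ∪ E (-1) n) := measure_biUnion_finset_le _ _
      _ ≤ ∑ n ∈ Finset.Ico 1 t, ENNReal.ofReal (2 * ((t : ℝ) ^ 5)⁻¹) := by
          refine Finset.sum_le_sum fun n hn => (measure_union_le _ _).trans ?_
          have hn1 := (Finset.mem_Ico.1 hn).1
          have hpos : 0 < τ a := pos_iff_ne_zero.2 ha
          rw [two_mul, ENNReal.ofReal_add (by positivity) (by positivity)]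
          exact add_le_add
            (h.measure_pulls_eq_deviation_le hsub hpos ht1 hn1 (by norm_num))
            (h.measure_pulls_eq_deviation_le hsub hpos ht1 hn1 (by norm_num))
      _ ≤ _ := by
          rw [Finset.sum_const, Nat.card_Ico, nsmul_eq_mul, ← ENNReal.ofReal_natCast,
            ← ENNReal.ofReal_mul (Nat.cast_nonneg _)]
          refine ENNReal.ofReal_le_ofReal ?_
          have : ((t - 1 : ℕ) : ℝ) ≤ t := by exact_mod_cast Nat.sub_le t 1
          calc ((t - 1 : ℕ) : ℝ) * (2 * ((t : ℝ) ^ 5)⁻¹) ≤ t * (2 * ((t : ℝ) ^ 5)⁻¹) := by gcongr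
            _ = _ := by field_simp

theorem measure_compl_accurate_le (hsub : P.SubGaussianWeights α τ) {t : ℕ} (ht : K < t) :
    μ (accurate P α τ A X t)ᶜ ≤ ENNReal.ofReal (2 * K / (t : ℝ) ^ 4) := by
  have : (accurate P α τ A X t)ᶜ = ⋃ a, {ω | runBoost τ A a t ω <
      |runEstimate P α A X a t ω - P.localMass α a|} := by
    ext ω
    simp [accurate]
  rw [this]
  refine (measure_iUnion_fintype_le _ _).trans ?_
  refine (Finset.sum_le_sum fun a _ => h.measure_deviation_le hsub a ht).trans (le_of_eq ?_)
  rw [Finset.sum_const, Finset.card_univ, Fintype.card_fin, nsmul_eq_mul,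
    ← ENNReal.ofReal_natCast, ← ENNReal.ofReal_mul (Nat.cast_nonneg _)]
  congr 1
  ring

end IsRun

end Daisee

/-! ### Deterministic estimates: cell probabilities, divergences and the recursion. -/

namespace Daisee

theorem exists_pos_le_of_forall_pos {ι : Type*} [Finite ι] (f : ι → ℝ) (hf : ∀ i, 0 < f i) :
    ∃ m, 0 < m ∧ ∀ i, m ≤ f i := by
  cases isEmpty_or_nonempty ι
  · exact ⟨1, one_pos, fun i => isEmptyElim i⟩
  · obtain ⟨i, hi⟩ := Finite.exists_min f
    exact ⟨f i, hf i, hi⟩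

/-- From $(x/y)^p \ge 1 - p \log(y/x)$ and $\log r \le r - 1$. One form serves every $p \ge 0$, with
no split between concave and convex powers. -/
theorem rpow_sub_rpow_le {p x y : ℝ} (hp : 0 ≤ p) (hx : 0 < x) (hy : 0 < y) :
    y ^ p - x ^ p ≤ p * y ^ p * ((y - x) / x) := by
  have hr : 0 < y / x := div_pos hy hx
  have h1 : 1 - p * (y / x - 1) ≤ (x / y) ^ p := by
    have hl := Real.log_le_sub_one_of_pos hr
    have he := Real.add_one_le_exp (Real.log (x / y) * p)
    rw [← Real.rpow_def_of_pos (div_pos hx hy), ← inv_div, Real.log_inv, inv_div] at he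
    nlinarith
  have h2 : (x / y) ^ p * y ^ p = x ^ p := by
    rw [Real.div_rpow hx.le hy.le, div_mul_cancel₀ _ (Real.rpow_pos_of_pos hy p).ne']
  have h3 : (y - x) / x = y / x - 1 := by
    field_simp
  rw [h3, ← h2]
  have := Real.rpow_pos_of_pos hy p
  nlinarith

theorem sqrt_log_le {α : ℝ} (hα : 0 < α) {t : ℝ} (ht : 1 ≤ t) :
    Real.sqrt (Real.log t) ≤ Real.sqrt (4 / α) * t ^ (α / 8) := by
  have ht0 : 0 < t := by linarith
  have h := Real.log_le_rpow_div ht0.le (ε := α / 4) (by positivity)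
  calc Real.sqrt (Real.log t) ≤ Real.sqrt (4 / α * (t ^ (α / 8)) ^ 2) := by
        refine Real.sqrt_le_sqrt (h.trans (le_of_eq ?_))
        rw [← Real.rpow_natCast, ← Real.rpow_mul ht0.le]
        have : α / 8 * ((2 : ℕ) : ℝ) = α / 4 := by push_cast; ring
        rw [this]
        field_simp
    _ = _ := by
        rw [Real.sqrt_mul (by positivity), Real.sqrt_sq (by positivity)]

/-- Bounding $\sqrt{\log t}$ by a multiple of $t^{\alpha/8}$ makes the power $1/\alpha$ produce
$t^{1/8}$ for every $\alpha$. -/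
theorem sum_rpow_le {K : ℕ} {α : ℝ} (hα : 0 < α) (ζ : Fin K → ℝ) (hζ : ∀ a, 0 < ζ a)
    (τ : Fin K → ℝ≥0) {t : ℝ} (ht : 1 ≤ t) (y : Fin K → ℝ) (hy0 : ∀ a, 0 ≤ y a)
    (hy : ∀ a, y a ≤ ζ a + 2 * (boostConst * τ a * Real.sqrt (Real.log t))) :
    ∑ a, y a ^ (1 / α) ≤
      (∑ a, (ζ a + 2 * (boostConst * τ a * Real.sqrt (4 / α))) ^ (1 / α)) * t ^ (1 / 8 : ℝ) := by
  have ht0 : 0 < t := by linarith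
  rw [Finset.sum_mul]
  refine Finset.sum_le_sum fun a _ => ?_
  have hc : 0 ≤ boostConst * τ a := mul_nonneg boostConst_nonneg (τ a).2
  have h1 : 1 ≤ t ^ (α / 8) := Real.one_le_rpow ht (by positivity)
  have h2 : y a ≤ (ζ a + 2 * (boostConst * τ a * Real.sqrt (4 / α))) * t ^ (α / 8) := by
    refine (hy a).trans ?_
    have := mul_le_mul_of_nonneg_left (sqrt_log_le hα ht) hc
    nlinarith [hζ a]
  refine (Real.rpow_le_rpow (hy0 a) h2 (by positivity)).trans (le_of_eq ?_)
  rw [Real.mul_rpow (by have := hζ a; positivity) (by positivity), ← Real.rpow_mul ht0.le]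
  congr 2
  field_simp

/-- Cell probabilities of the optimistic estimates are bounded below by a small power of the
time. -/
theorem exists_prob_lower_bound {K : ℕ} {α : ℝ} (hα : 0 < α) (ζ : Fin K → ℝ)
    (hζ : ∀ a, 0 < ζ a) (τ : Fin K → ℝ≥0) :
    ∃ c, 0 < c ∧ c ≤ 1 / 2 ∧ ∀ (t : ℝ) (y : Fin K → ℝ), 1 ≤ t →
      (∀ a, ζ a ≤ y a) → (∀ a, y a ≤ ζ a + 2 * (boostConst * τ a * Real.sqrt (Real.log t))) →
      ∀ a, c * t ^ (-(1 / 8) : ℝ) ≤ y a ^ (1 / α) / ∑ b, y b ^ (1 / α) := by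
  obtain ⟨m, hm, hmle⟩ := exists_pos_le_of_forall_pos (fun a => ζ a ^ (1 / α))
    fun a => Real.rpow_pos_of_pos (hζ a) _
  set C := ∑ a, (ζ a + 2 * (boostConst * τ a * Real.sqrt (4 / α))) ^ (1 / α) with hC
  have hC0 : 0 ≤ C := Finset.sum_nonneg fun a _ => Real.rpow_nonneg (by
    have := hζ a
    have := boostConst_nonneg
    positivity) _
  refine ⟨min (1 / 2) (m / (C + 1)), lt_min (by norm_num) (by positivity), min_le_left _ _, ?_⟩
  intro t y ht hy1 hy2 a
  have ht0 : 0 < t := by linarith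
  have hy0 : ∀ a, 0 < y a := fun a => (hζ a).trans_le (hy1 a)
  have hD := sum_rpow_le hα ζ hζ τ ht y (fun a => (hy0 a).le) hy2
  have hDpos : 0 < ∑ b, y b ^ (1 / α) :=
    Finset.sum_pos (fun b _ => Real.rpow_pos_of_pos (hy0 b) _) ⟨a, Finset.mem_univ a⟩
  have ht8 : 0 < t ^ (1 / 8 : ℝ) := Real.rpow_pos_of_pos ht0 _
  rw [le_div_iff₀ hDpos, Real.rpow_neg ht0.le]
  calc min (1 / 2) (m / (C + 1)) * (t ^ (1 / 8 : ℝ))⁻¹ * ∑ b, y b ^ (1 / α)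
      ≤ m / (C + 1) * (t ^ (1 / 8 : ℝ))⁻¹ * ((C + 1) * t ^ (1 / 8 : ℝ)) := by
        gcongr
        · exact min_le_right _ _
        · exact hD.trans (by gcongr; linarith)
    _ = m := by field_simp
    _ ≤ ζ a ^ (1 / α) := hmle a
    _ ≤ y a ^ (1 / α) := Real.rpow_le_rpow (hζ a).le (hy1 a) (by positivity)

theorem mul_alphaLoss_le {α p w : ℝ} (hα : 0 < α) (hα2 : α ≤ 2) (hp : 0 ≤ p) (hw : 0 < w) :
    w * alphaLoss α (p / w) ≤ (1 + 1 / α) * ((p - w) ^ 2 / w) := by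
  calc w * alphaLoss α (p / w) ≤ w * ((1 + 1 / α) * (p / w - 1) ^ 2) := by
        gcongr
        exact alphaLoss_le_sq hα hα2 (by positivity)
    _ = _ := by field_simp

/-- The divergence between the cell probabilities of estimates and of masses is quadratic in the
errors of the estimates. -/
theorem exists_divergence_le_sq {K : ℕ} {α : ℝ} (hα : 0 < α) (hα2 : α ≤ 2) (ζ : Fin K → ℝ)
    (hζ : ∀ a, 0 < ζ a) (τ : Fin K → ℝ≥0) :
    ∃ C, 0 ≤ C ∧ ∀ (t : ℝ) (y σ : Fin K → ℝ), 1 ≤ t →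
      (∀ a, ζ a ≤ y a) → (∀ a, y a ≤ ζ a + 2 * σ a) →
      (∀ a, σ a ≤ boostConst * τ a * Real.sqrt (Real.log t)) →
      ∑ a, y a ^ (1 / α) / (∑ b, y b ^ (1 / α)) * alphaLoss α
        ((ζ a ^ (1 / α) / ∑ b, ζ b ^ (1 / α)) / (y a ^ (1 / α) / ∑ b, y b ^ (1 / α))) ≤
      C * t ^ (1 / 8 : ℝ) * ∑ a, σ a ^ 2 := by
  obtain ⟨c, hc, -, hlow⟩ := exists_prob_lower_bound hα ζ hζ τ
  obtain ⟨m, hm, hmle⟩ := exists_pos_le_of_forall_pos ζ hζ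
  -- The factor $4/(\alpha m)$ bounds the error of a probability relative to $\sum_a \sigma_a$, and
  -- $c$ comes from the lower bound on the denominator. One $K$ counts the arms, the other comes
  -- from $(\sum_a \sigma_a)^2 \le K \sum_a \sigma_a^2$.
  refine ⟨K * ((1 + 1 / α) * ((4 / (α * m)) ^ 2 / c)) * K, by positivity, ?_⟩
  intro t y σ ht hy1 hy2 hσ
  have ht0 : 0 < t := by linarith
  have hy0 : ∀ a, 0 < y a := fun a => (hζ a).trans_le (hy1 a)
  have hσ0 : ∀ a, 0 ≤ σ a := fun a => by linarith [hy1 a, hy2 a]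
  have hyp : ∀ a, 0 < y a ^ (1 / α) := fun a => Real.rpow_pos_of_pos (hy0 a) _
  have hζp : ∀ a, 0 < ζ a ^ (1 / α) := fun a => Real.rpow_pos_of_pos (hζ a) _
  set D := ∑ b, y b ^ (1 / α) with hD
  set E := ∑ b, ζ b ^ (1 / α) with hE
  have hdiff : ∀ a, y a ^ (1 / α) - ζ a ^ (1 / α) ≤ y a ^ (1 / α) * (2 / (α * m) * σ a) := by
    intro a
    have h1 := rpow_sub_rpow_le (p := 1 / α) (by positivity) (hζ a) (hy0 a)
    have h2 : (y a - ζ a) / ζ a ≤ 2 * σ a / m := by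
      gcongr
      · have := hσ0 a; positivity
      · linarith [hy2 a]
      · exact hmle a
    calc y a ^ (1 / α) - ζ a ^ (1 / α) ≤ 1 / α * y a ^ (1 / α) * (2 * σ a / m) := by
          refine h1.trans ?_
          have := hyp a
          gcongr
      _ = _ := by field_simp
  set s := ∑ b, σ b with hs
  have hs0 : 0 ≤ s := Finset.sum_nonneg fun b _ => hσ0 b
  have hσs : ∀ a, σ a ≤ s := fun a =>
    Finset.single_le_sum (fun b _ => hσ0 b) (Finset.mem_univ a)
  have hk : 0 ≤ 2 / (α * m) := by positivity
  have hDE : D - E ≤ D * (2 / (α * m) * s) := by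
    rw [hD, hE, ← Finset.sum_sub_distrib, Finset.sum_mul]
    refine Finset.sum_le_sum fun a _ => (hdiff a).trans ?_
    have := hyp a
    gcongr
    exact hσs a
  have hED : E ≤ D := Finset.sum_le_sum fun a _ =>
    Real.rpow_le_rpow (hζ a).le (hy1 a) (by positivity)
  have hterm : ∀ a, y a ^ (1 / α) / D * alphaLoss α
        ((ζ a ^ (1 / α) / E) / (y a ^ (1 / α) / D)) ≤
      (1 + 1 / α) * ((4 / (α * m)) ^ 2 / c) * (t ^ (1 / 8 : ℝ) * s ^ 2) := by
    intro a
    have hEpos : 0 < E := Finset.sum_pos (fun b _ => hζp b) ⟨a, Finset.mem_univ a⟩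
    have hDpos : 0 < D := hEpos.trans_le hED
    have hwpos : 0 < y a ^ (1 / α) / D := div_pos (hyp a) hDpos
    have hζE : ζ a ^ (1 / α) ≤ E :=
      Finset.single_le_sum (fun b _ => (hζp b).le) (Finset.mem_univ a)
    have hyD : y a ^ (1 / α) ≤ D :=
      Finset.single_le_sum (fun b _ => (hyp b).le) (Finset.mem_univ a)
    have hζy : ζ a ^ (1 / α) ≤ y a ^ (1 / α) :=
      Real.rpow_le_rpow (hζ a).le (hy1 a) (by positivity)
    have h1 : ζ a ^ (1 / α) / E - y a ^ (1 / α) / D ≤ 4 / (α * m) * s := by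
      have e1 : ζ a ^ (1 / α) / E - y a ^ (1 / α) / D ≤ ζ a ^ (1 / α) / E * ((D - E) / D) := by
        have : ζ a ^ (1 / α) / E - ζ a ^ (1 / α) / D = ζ a ^ (1 / α) / E * ((D - E) / D) := by
          field_simp
        rw [← this]
        gcongr
      have e2 : ζ a ^ (1 / α) / E ≤ 1 := div_le_one_of_le₀ hζE hEpos.le
      have e3 : (D - E) / D ≤ 2 / (α * m) * s := by
        rw [div_le_iff₀ hDpos]; linarith
      have e4 : 0 ≤ (D - E) / D := div_nonneg (by linarith) hDpos.le
      have e5 : 4 / (α * m) * s = 2 * (2 / (α * m) * s) := by ring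
      nlinarith
    have h2 : y a ^ (1 / α) / D - ζ a ^ (1 / α) / E ≤ 4 / (α * m) * s := by
      have e1 : y a ^ (1 / α) / D - ζ a ^ (1 / α) / E ≤
          (y a ^ (1 / α) - ζ a ^ (1 / α)) / D := by
        rw [sub_div]
        gcongr
        exact (hζp a).le
      have e2 : (y a ^ (1 / α) - ζ a ^ (1 / α)) / D ≤ 2 / (α * m) * σ a := by
        rw [div_le_iff₀ hDpos]
        refine (hdiff a).trans ?_
        rw [mul_comm]
        have := hσ0 a
        gcongr
      have e3 : 2 / (α * m) * σ a ≤ 2 / (α * m) * s := by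
        gcongr
        exact hσs a
      have e5 : 4 / (α * m) * s = 2 * (2 / (α * m) * s) := by ring
      have e6 : 0 ≤ 2 / (α * m) * s := by positivity
      linarith
    have h3 : (ζ a ^ (1 / α) / E - y a ^ (1 / α) / D) ^ 2 ≤ (4 / (α * m) * s) ^ 2 :=
      sq_le_sq' (by linarith) h1
    have h4 : c * t ^ (-(1 / 8) : ℝ) ≤ y a ^ (1 / α) / D := hlow t y ht hy1
      (fun a => (hy2 a).trans (by linarith [hσ a])) a
    refine (mul_alphaLoss_le hα hα2 (div_pos (hζp a) hEpos).le hwpos).trans ?_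
    have hct : 0 < c * t ^ (-(1 / 8) : ℝ) := by positivity
    calc (1 + 1 / α) * ((ζ a ^ (1 / α) / E - y a ^ (1 / α) / D) ^ 2 / (y a ^ (1 / α) / D))
        ≤ (1 + 1 / α) * ((4 / (α * m) * s) ^ 2 / (c * t ^ (-(1 / 8) : ℝ))) := by gcongr
      _ = _ := by
        rw [Real.rpow_neg ht0.le]
        field_simp
  have hsq : s ^ 2 ≤ K * ∑ a, σ a ^ 2 := by
    simpa using sq_sum_le_card_mul_sum_sq (s := Finset.univ) (f := σ)
  calc _ ≤ ∑ _a : Fin K, (1 + 1 / α) * ((4 / (α * m)) ^ 2 / c) * (t ^ (1 / 8 : ℝ) * s ^ 2) :=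
        Finset.sum_le_sum fun a _ => hterm a
    _ = K * ((1 + 1 / α) * ((4 / (α * m)) ^ 2 / c)) * (t ^ (1 / 8 : ℝ) * s ^ 2) := by
        simp [mul_assoc]
    _ ≤ K * ((1 + 1 / α) * ((4 / (α * m)) ^ 2 / c)) *
        (t ^ (1 / 8 : ℝ) * (K * ∑ a, σ a ^ 2)) := by gcongr
    _ = _ := by ring

/-- A bound on the divergence that holds without any accuracy of the estimates. -/
theorem exists_divergence_le {α : ℝ} (hα : 0 < α) (hα2 : α ≤ 2) :
    ∃ C, 0 ≤ C ∧ ∀ (K : ℕ), 0 < K → ∀ (p y : Fin K → ℝ), (∀ a, 0 ≤ p a) → ∑ a, p a = 1 →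
      (∀ a, 0 < y a) →
      ∑ a, y a ^ (1 / α) / (∑ b, y b ^ (1 / α)) * alphaLoss α
        (p a / (y a ^ (1 / α) / ∑ b, y b ^ (1 / α))) ≤
      C * ((K + ∑ a, y a) * (K + ∑ a, (y a)⁻¹)) := by
  have aux : ∀ K : ℕ, 0 < K → ∀ y : Fin K → ℝ, (∀ a, 0 < y a) →
      (∀ a, 0 < y a ^ (1 / α) / ∑ b, y b ^ (1 / α)) ∧
      (∀ a, y a ^ (1 / α) / ∑ b, y b ^ (1 / α) ≤ 1) ∧
      ∑ a, y a ^ (1 / α) / ∑ b, y b ^ (1 / α) = 1 := by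
    intro K hK y hy
    have hyp : ∀ a, 0 < y a ^ (1 / α) := fun a => Real.rpow_pos_of_pos (hy a) _
    have hD : 0 < ∑ b, y b ^ (1 / α) :=
      Finset.sum_pos (fun b _ => hyp b) ⟨⟨0, hK⟩, Finset.mem_univ _⟩
    refine ⟨fun a => div_pos (hyp a) hD, fun a => div_le_one_of_le₀ ?_ hD.le, ?_⟩
    · exact Finset.single_le_sum (fun b _ => (hyp b).le) (Finset.mem_univ a)
    · rw [← Finset.sum_div, div_self hD.ne']
  -- For $\alpha < 1$ the linear bound on the loss already gives a constant. For $\alpha \ge 1$ the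
  -- quadratic bound leaves $1/w_a$, and $x^{1/\alpha} \le 1 + x$ controls both the normaliser and
  -- $y_a^{-1/\alpha}$.
  rcases lt_or_ge α 1 with h1 | h1
  · have h1' : 0 < 1 - α := by linarith
    refine ⟨1 / α + 1 / (1 - α), by positivity, fun K hK p y hp hp1 hy => ?_⟩
    obtain ⟨hw, -, hw1⟩ := aux K hK y hy
    set w := fun a => y a ^ (1 / α) / ∑ b, y b ^ (1 / α) with hwdef
    have hKR : (1 : ℝ) ≤ K := by exact_mod_cast hK
    have hA : (1 : ℝ) ≤ K + ∑ a, y a := by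
      linarith [Finset.sum_nonneg fun a (_ : a ∈ Finset.univ) => (hy a).le]
    have hB : (1 : ℝ) ≤ K + ∑ a, (y a)⁻¹ := by
      linarith [Finset.sum_nonneg fun a (_ : a ∈ Finset.univ) => (inv_pos.2 (hy a)).le]
    calc ∑ a, w a * alphaLoss α (p a / w a) ≤ ∑ a, (w a / α + p a / (1 - α)) := by
          refine Finset.sum_le_sum fun a _ => ?_
          have hwa : 0 < w a := hw a
          calc w a * alphaLoss α (p a / w a) ≤ w a * (1 / α + p a / w a / (1 - α)) := by
                gcongr
                exact alphaLoss_le_linear hα h1 (div_nonneg (hp a) (hw a).le)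
            _ = _ := by field_simp
      _ = 1 / α + 1 / (1 - α) := by
          rw [Finset.sum_add_distrib, ← Finset.sum_div Finset.univ w, ← Finset.sum_div Finset.univ p,
            hw1, hp1]
      _ ≤ (1 / α + 1 / (1 - α)) * ((K + ∑ a, y a) * (K + ∑ a, (y a)⁻¹)) := by
          refine le_mul_of_one_le_right (by positivity) ?_
          nlinarith
  · refine ⟨1 + 1 / α, by positivity, fun K hK p y hp hp1 hy => ?_⟩
    obtain ⟨hw, hwle, hw1⟩ := aux K hK y hy
    have hple : ∀ a, p a ≤ 1 := fun a => by
      rw [← hp1]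
      exact Finset.single_le_sum (fun b _ => hp b) (Finset.mem_univ a)
    have hpow : ∀ x : ℝ, 0 < x → x ^ (1 / α) ≤ 1 + x := fun x hx => by
      have hq : 1 / α ≤ 1 := by rw [div_le_one hα]; exact h1
      have := rpow_one_add_le_one_add_mul_self (s := x) (p := 1 / α) (by linarith)
        (by positivity) hq
      calc x ^ (1 / α) ≤ (1 + x) ^ (1 / α) := by
            refine Real.rpow_le_rpow hx.le (by linarith) (by positivity)
        _ ≤ 1 + 1 / α * x := this
        _ ≤ 1 + x := by nlinarith
    have hD : ∑ b, y b ^ (1 / α) ≤ K + ∑ a, y a := by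
      refine (Finset.sum_le_sum fun b _ => hpow _ (hy b)).trans (le_of_eq ?_)
      simp [Finset.sum_add_distrib]
    have hD0 : 0 ≤ ∑ b, y b ^ (1 / α) :=
      Finset.sum_nonneg fun b _ => (Real.rpow_pos_of_pos (hy b) _).le
    calc _ ≤ ∑ a, (1 + 1 / α) * ((K + ∑ a, y a) * (1 + (y a)⁻¹)) := by
          refine Finset.sum_le_sum fun a _ => ?_
          refine (mul_alphaLoss_le hα hα2 (hp a) (hw a)).trans ?_
          gcongr
          set w := y a ^ (1 / α) / ∑ b, y b ^ (1 / α) with hwdef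
          calc (p a - w) ^ 2 / w ≤ 1 / w := by
                have h2 : 0 < w := hw a
                gcongr
                have h3 := hple a
                have h4 := hp a
                have h5 : w ≤ 1 := hwle a
                nlinarith
            _ = (∑ b, y b ^ (1 / α)) * (y a)⁻¹ ^ (1 / α) := by
                rw [hwdef, one_div_div, Real.inv_rpow (hy a).le, div_eq_mul_inv]
            _ ≤ (K + ∑ a, y a) * (1 + (y a)⁻¹) := by
                have h6 := hpow _ (inv_pos.2 (hy a))
                have h7 : 0 ≤ (y a)⁻¹ ^ (1 / α) := Real.rpow_nonneg (inv_pos.2 (hy a)).le _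
                exact mul_le_mul hD h6 h7 (hD0.trans hD)
      _ = _ := by
          rw [← Finset.mul_sum, ← Finset.mul_sum, Finset.sum_add_distrib]
          simp

/-- A recursion with quadratic drift forces decay at nearly the rate `1 / t`. -/
theorem exists_recursion_bound (K : ℕ) {c : ℝ} (hc : 0 < c) (hc2 : c ≤ 1 / 2) :
    ∃ B, 0 ≤ B ∧ ∀ u : ℕ → ℝ, (∀ t, u t ≤ 1) →
      (∀ t, K < t → ∀ v, 0 ≤ v → u (t + 1) ≤
        u t - c * (t : ℝ) ^ (-(1 / 8) : ℝ) * (2 * v * u t - v ^ 2) / 2 + K / (t : ℝ) ^ 4) →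
      ∀ t, K < t → u t ≤ B * (t : ℝ) ^ (-(7 / 8) : ℝ) := by
  -- The summand $K + 1$ covers the start and the error $K/t^4$; $4/c$ makes the drift strong enough
  -- for the induction.
  refine ⟨4 / c + (K + 1), by positivity, fun u hu1 hrec t ht => ?_⟩
  set B : ℝ := 4 / c + (K + 1) with hB
  have hB0 : 0 < B := by positivity
  have hBK : (K : ℝ) + 1 ≤ B := by rw [hB]; linarith [div_pos four_pos hc]
  have hBc : 4 ≤ c * B := by
    rw [hB, mul_add, mul_div_cancel₀ _ hc.ne']
    nlinarith [(Nat.cast_nonneg K : (0 : ℝ) ≤ K)]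
  have hpow : ∀ s : ℝ, 1 ≤ s → s⁻¹ ≤ s ^ (-(7 / 8) : ℝ) := fun s hs => by
    rw [← Real.rpow_neg_one]
    exact Real.rpow_le_rpow_of_exponent_le hs (by norm_num)
  induction t, ht using Nat.le_induction with
  | base =>
    refine (hu1 _).trans ?_
    have h1 := hpow ((K + 1 : ℕ) : ℝ) (by push_cast; linarith [(Nat.cast_nonneg K : (0 : ℝ) ≤ K)])
    have h2 : (0 : ℝ) < (K + 1 : ℕ) := by positivity
    calc (1 : ℝ) = ((K + 1 : ℕ) : ℝ) * ((K + 1 : ℕ) : ℝ)⁻¹ := by field_simp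
      _ ≤ B * ((K + 1 : ℕ) : ℝ) ^ (-(7 / 8) : ℝ) := by
        gcongr
        push_cast
        exact hBK
  | succ t ht ih =>
    have htK : K < t := ht
    have ht1 : (1 : ℝ) ≤ t := by exact_mod_cast (by omega : 1 ≤ t)
    have ht0 : (0 : ℝ) < t := by linarith
    push_cast
    -- As long as the claimed bound exceeds $1$ it is trivial. Afterwards $B \le t + 1$, hence $qv =
    -- cB/t \le 1$, so the coefficient $1 - qv$ of $u_t$ is nonnegative and the induction hypothesis
    -- can be inserted.
    by_cases hbig : 1 ≤ B * ((t : ℝ) + 1) ^ (-(7 / 8) : ℝ)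
    · exact (hu1 _).trans hbig
    · have hBt : B ≤ t + 1 := by
        have h1 := hpow ((t : ℝ) + 1) (by linarith)
        have h2 : B * ((t : ℝ) + 1)⁻¹ < 1 :=
          (mul_le_mul_of_nonneg_left h1 hB0.le).trans_lt (not_le.1 hbig)
        rw [← div_eq_mul_inv, div_lt_one (by linarith)] at h2
        exact h2.le
      set v : ℝ := B * (t : ℝ) ^ (-(7 / 8) : ℝ) with hv
      set q : ℝ := c * (t : ℝ) ^ (-(1 / 8) : ℝ) with hq
      have hv0 : 0 ≤ v := by positivity
      have hqv : q * v = c * B * (t : ℝ)⁻¹ := by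
        rw [hq, hv, ← Real.rpow_neg_one, mul_mul_mul_comm, ← Real.rpow_add ht0]
        norm_num
      have hqv1 : q * v ≤ 1 := by
        rw [hqv, ← div_eq_mul_inv, div_le_one ht0]
        nlinarith
      -- Linearising at the inductive bound $v$ itself leaves $v - qv^2/2 + K/t^4$. The gain $qv^2/2
      -- \ge 2v/t$ pays both for $K/t^4 \le v/t$ and for the decrease of the bound from $t$ to $t +
      -- 1$, which is at most $v/t$.
      have hr := hrec t htK v hv0
      have h3 : u t * (1 - q * v) ≤ v * (1 - q * v) :=
        mul_le_mul_of_nonneg_right ih (by linarith)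
      have h4 : (K : ℝ) / (t : ℝ) ^ 4 ≤ K * ((t : ℝ) ^ (-(7 / 8) : ℝ) * (t : ℝ)⁻¹) := by
        rw [div_eq_mul_inv]
        gcongr
        rw [← Real.rpow_neg_one (t : ℝ), ← Real.rpow_add ht0, ← Real.rpow_natCast, ← Real.rpow_neg ht0.le]
        exact Real.rpow_le_rpow_of_exponent_le ht1 (by norm_num)
      have h5 : q * v * v / 2 ≥ 2 * B * ((t : ℝ) ^ (-(7 / 8) : ℝ) * (t : ℝ)⁻¹) := by
        rw [hqv, hv]
        have h6 : 0 ≤ B * ((t : ℝ) ^ (-(7 / 8) : ℝ) * (t : ℝ)⁻¹) := by positivity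
        have h7 := mul_le_mul_of_nonneg_right hBc h6
        nlinarith
      have h8 : B * (t : ℝ) ^ (-(7 / 8) : ℝ) * (1 - (t : ℝ)⁻¹) ≤
          B * ((t : ℝ) + 1) ^ (-(7 / 8) : ℝ) := by
        rw [mul_assoc]
        gcongr
        have h9 : ((t : ℝ) + 1) ^ (-(7 / 8) : ℝ) =
            (t : ℝ) ^ (-(7 / 8) : ℝ) * (((t : ℝ) + 1) / t) ^ (-(7 / 8) : ℝ) := by
          rw [← Real.mul_rpow ht0.le (by positivity), mul_div_cancel₀ _ ht0.ne']
        rw [h9]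
        gcongr
        refine le_trans ?_ (hpow _ (by rw [le_div_iff₀ ht0]; linarith))
        rw [inv_div, le_div_iff₀ (by linarith)]
        field_simp
        nlinarith
      have h10 : 0 ≤ (t : ℝ) ^ (-(7 / 8) : ℝ) * (t : ℝ)⁻¹ := by positivity
      nlinarith

end Daisee

/-! ### Expected inverse pull counts and moments of the estimates along a run. -/

namespace Daisee

variable {K : ℕ} {𝒳 : Type*} [MeasurableSpace 𝒳] {P : Problem K 𝒳} {α : ℝ} {τ : Fin K → ℝ≥0}
  {Ω : Type*} {A : ℕ → Ω → Fin K} {X : ℕ → Ω → 𝒳}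

theorem localMass_le_runScore {t : ℕ} {ω : Ω} (hω : ω ∈ accurate P α τ A X t) (a : Fin K) :
    P.localMass α a ≤ runScore P α τ A X a t ω := by
  have := (abs_le.1 (hω a)).1
  rw [runScore]
  linarith

theorem runScore_le {t : ℕ} {ω : Ω} (hω : ω ∈ accurate P α τ A X t) (a : Fin K) :
    runScore P α τ A X a t ω ≤ P.localMass α a + 2 * runBoost τ A a t ω := by
  have := (abs_le.1 (hω a)).2
  rw [runScore]
  linarith

theorem runBoost_le {t : ℕ} (ht : 1 ≤ t) {ω : Ω} {a : Fin K} (hN : 1 ≤ runPulls A a t ω) :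
    runBoost τ A a t ω ≤ boostConst * τ a * Real.sqrt (Real.log t) := by
  rw [runBoost_eq]
  have h1 : 0 ≤ Real.log t := Real.log_nonneg (by exact_mod_cast ht)
  have h2 : (1 : ℝ) ≤ runPulls A a t ω := by exact_mod_cast hN
  have h3 : 0 ≤ boostConst * τ a := mul_nonneg boostConst_nonneg (τ a).2
  gcongr
  exact div_le_self h1 h2

theorem le_runBoost {t : ℕ} (ht : 2 ≤ t) {ω : Ω} {a : Fin K} (hN : 1 ≤ runPulls A a t ω) :
    boostConst * τ a * Real.sqrt (Real.log 2) * (Real.sqrt t)⁻¹ ≤ runBoost τ A a t ω := by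
  rw [runBoost_eq, mul_assoc _ (Real.sqrt _), ← div_eq_mul_inv,
    ← Real.sqrt_div (Real.log_nonneg one_le_two)]
  have h2 : (0 : ℝ) < runPulls A a t ω := by exact_mod_cast hN
  have h3 : 0 ≤ boostConst * τ a := mul_nonneg boostConst_nonneg (τ a).2
  have h4 : (2 : ℝ) ≤ t := by exact_mod_cast ht
  have h5 : (runPulls A a t ω : ℝ) ≤ t := by exact_mod_cast (runPulls_lt A a (by omega) ω).le
  have h6 : 0 ≤ Real.log 2 := Real.log_nonneg one_le_two
  gcongr

theorem runBoost_sq {t : ℕ} (ht : 1 ≤ t) (ω : Ω) (a : Fin K) :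
    runBoost τ A a t ω ^ 2 =
      boostConst ^ 2 * (τ a : ℝ) ^ 2 * (Real.log t * (runPulls A a t ω : ℝ)⁻¹) := by
  have h1 : 0 ≤ Real.log t := Real.log_nonneg (by exact_mod_cast ht)
  rw [runBoost_eq, mul_pow, mul_pow, Real.sq_sqrt (by positivity), div_eq_mul_inv]

/-- Cauchy–Schwarz, then discarding the random factor $1/N_a$. What remains is a sum over rounds
whose expectation can be taken term by term; the resulting loss of a factor $t$ is harmless where it
is used. -/
theorem runEstimate_sq_le (a : Fin K) {t : ℕ} (ω : Ω) :
    runEstimate P α A X a t ω ^ 2 ≤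
      ∑ l ∈ Finset.Ico 1 t, if A l ω = a then P.weight α a (X l ω) ^ 2 else 0 := by
  set S := (Finset.Ico 1 t).filter fun l => A l ω = a with hS
  have hN : runPulls A a t ω = S.card := rfl
  rw [runEstimate_eq, runSum, ← Finset.sum_filter, ← Finset.sum_filter, hN, ← hS]
  have hQ : 0 ≤ ∑ l ∈ S, P.weight α a (X l ω) ^ 2 := Finset.sum_nonneg fun l _ => sq_nonneg _
  rcases S.card.eq_zero_or_pos with h0 | h0
  · simpa [h0] using hQ
  · have h1 : (1 : ℝ) ≤ S.card := by exact_mod_cast h0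
    rw [div_pow, div_le_iff₀ (by positivity)]
    refine sq_sum_le_card_mul_sum_sq.trans ?_
    rw [mul_comm]
    gcongr
    nlinarith

namespace IsRun

variable [MeasurableSpace Ω] {μ : Measure Ω} [IsProbabilityMeasure μ] (h : IsRun P α τ μ A X)
include h

theorem integral_arm_mul {t : ℕ} (ht : 1 ≤ t) (a : Fin K) {G : Ω → ℝ}
    (hG : Measurable[past A X t] G) (hG0 : ∀ ω, 0 ≤ G ω) :
    ∫ ω, {ω | A t ω = a}.indicator 1 ω * G ω ∂μ = ∫ ω, runProb P α τ A X t a ω * G ω ∂μ := by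
  have hm := h.past_le t
  have hG' : Measurable G := hG.mono hm le_rfl
  have hq : Measurable (runProb P α τ A X t a) := (measurable_runProb P α τ A X t a).mono hm le_rfl
  have hI : Measurable ({ω | A t ω = a}.indicator (1 : Ω → ℝ)) :=
    measurable_one.indicator (h.measurableSet_arm t a)
  have hI0 : ∀ ω, 0 ≤ {ω | A t ω = a}.indicator (1 : Ω → ℝ) ω := fun ω =>
    Set.indicator_nonneg (fun _ _ => zero_le_one) ω
  rw [integral_eq_lintegral_of_nonneg_ae
      (Eventually.of_forall fun ω => mul_nonneg (hI0 ω) (hG0 ω))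
      (hI.mul hG').aestronglyMeasurable,
    integral_eq_lintegral_of_nonneg_ae
      (Eventually.of_forall fun ω => mul_nonneg (runProb_nonneg P α τ A X t a ω) (hG0 ω))
      (hq.mul hG').aestronglyMeasurable]
  congr 1
  simp_rw [ENNReal.ofReal_mul (runProb_nonneg P α τ A X t a _)]
  rw [← h.lintegral_arm_mul ht a hG.ennreal_ofReal]
  refine lintegral_congr fun ω => ?_
  by_cases hω : A t ω = a <;> simp [hω]

omit [IsProbabilityMeasure μ] in
theorem measurable_inv_runPulls (a : Fin K) (t : ℕ) :
    Measurable fun ω => (runPulls A a t ω : ℝ)⁻¹ :=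
  ((measurable_runPulls_cast A X a t).mono (h.past_le t) le_rfl).inv


theorem integrable_inv_runPulls (a : Fin K) (t : ℕ) :
    Integrable (fun ω => (runPulls A a t ω : ℝ)⁻¹) μ :=
  Integrable.of_bound (h.measurable_inv_runPulls a t).aestronglyMeasurable 1
    (Eventually.of_forall fun ω => by
      rw [Real.norm_of_nonneg (by positivity)]
      exact Nat.cast_inv_le_one _)

theorem integral_inv_runPulls_le_one (a : Fin K) (t : ℕ) :
    ∫ ω, (runPulls A a t ω : ℝ)⁻¹ ∂μ ≤ 1 := by
  have := integral_mono (h.integrable_inv_runPulls a t) (integrable_const (1 : ℝ))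
    fun ω => Nat.cast_inv_le_one (runPulls A a t ω)
  simpa using this

theorem measureReal_compl_accurate_le (hsub : P.SubGaussianWeights α τ) {t : ℕ} (ht : K < t) :
    μ.real (accurate P α τ A X t)ᶜ ≤ 2 * K / (t : ℝ) ^ 4 :=
  ENNReal.toReal_le_of_le_ofReal (by positivity) (h.measure_compl_accurate_le hsub ht)

/-- The mean inverse number of pulls has a quadratic negative drift. -/
theorem integral_inv_runPulls_succ_le (hsub : P.SubGaussianWeights α τ) {q : ℝ} (hq0 : 0 ≤ q)
    (hq1 : q ≤ 1) {t : ℕ} (ht : K < t) (a : Fin K)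
    (hlow : ∀ᵐ ω ∂μ, ω ∈ accurate P α τ A X t → q ≤ runProb P α τ A X t a ω) (v : ℝ) :
    ∫ ω, (runPulls A a (t + 1) ω : ℝ)⁻¹ ∂μ ≤ ∫ ω, (runPulls A a t ω : ℝ)⁻¹ ∂μ -
      q * (2 * v * ∫ ω, (runPulls A a t ω : ℝ)⁻¹ ∂μ - v ^ 2) / 2 + K / (t : ℝ) ^ 4 := by
  have ht1 : 1 ≤ t := by omega
  have hm := h.past_le t
  have hGm : Measurable[past A X t] fun ω => (runPulls A a t ω : ℝ)⁻¹ ^ 2 :=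
    (measurable_runPulls_cast A X a t).inv.pow_const 2
  have hG01 : ∀ ω, 0 ≤ (runPulls A a t ω : ℝ)⁻¹ ^ 2 ∧ (runPulls A a t ω : ℝ)⁻¹ ^ 2 ≤ 1 :=
    fun ω => ⟨by positivity, pow_le_one₀ (by positivity) (Nat.cast_inv_le_one _)⟩
  have hIm : Measurable ({ω | A t ω = a}.indicator (1 : Ω → ℝ)) :=
    measurable_one.indicator (h.measurableSet_arm t a)
  have hbad : MeasurableSet (accurate P α τ A X t)ᶜ :=
    (hm _ (measurableSet_accurate P α τ A X t)).compl
  have hN := h.integrable_inv_runPulls a t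
  have hi1 : Integrable (fun ω => {ω | A t ω = a}.indicator (1 : Ω → ℝ) ω *
      (runPulls A a t ω : ℝ)⁻¹ ^ 2) μ :=
    Integrable.of_bound (hIm.mul (hGm.mono hm le_rfl)).aestronglyMeasurable 1
      (Eventually.of_forall fun ω => by
        by_cases hω : A t ω = a
        · simpa [hω] using (hG01 ω).2
        · simp [hω])
  have hi2 : Integrable (fun ω => runProb P α τ A X t a ω * (runPulls A a t ω : ℝ)⁻¹ ^ 2) μ :=
    Integrable.of_bound (((measurable_runProb P α τ A X t a).mono hm le_rfl).mul
      (hGm.mono hm le_rfl)).aestronglyMeasurable 1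
      (Eventually.of_forall fun ω => by
        have h0 := runProb_nonneg P α τ A X t a ω
        rw [Real.norm_of_nonneg (mul_nonneg h0 (hG01 ω).1)]
        exact mul_le_one₀ (runProb_le_one P α τ A X t a ω) (hG01 ω).1 (hG01 ω).2)
  have hi3 : Integrable ((accurate P α τ A X t)ᶜ.indicator fun _ => (1 : ℝ)) μ :=
    (integrable_const _).indicator hbad
  have hi4 : Integrable (fun ω => q * (2 * v * (runPulls A a t ω : ℝ)⁻¹ - v ^ 2)) μ :=
    ((hN.const_mul _).sub (integrable_const _)).const_mul _
  have s1 : ∫ ω, (runPulls A a (t + 1) ω : ℝ)⁻¹ ∂μ ≤ ∫ ω, ((runPulls A a t ω : ℝ)⁻¹ -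
      {ω | A t ω = a}.indicator (1 : Ω → ℝ) ω * (runPulls A a t ω : ℝ)⁻¹ ^ 2 / 2) ∂μ := by
    refine integral_mono_ae (h.integrable_inv_runPulls a (t + 1)) (hN.sub (hi1.div_const 2)) ?_
    filter_upwards [h.ae_one_le_runPulls ht a] with ω hω
    have hN1 : (1 : ℝ) ≤ runPulls A a t ω := by exact_mod_cast hω
    rw [runPulls_succ A a ht1]
    by_cases hA : A t ω = a
    · simp only [hA, if_true, Set.indicator_apply, Set.mem_ofPred_eq, Pi.one_apply, one_mul]
      push_cast
      set n : ℝ := (runPulls A a t ω : ℝ)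
      -- For $n \ge 1$ a further pull therefore lowers $1/n$ by at least half of its square.
      have e : n⁻¹ - n⁻¹ ^ 2 / 2 - (n + 1)⁻¹ = (n - 1) / (2 * n ^ 2 * (n + 1)) := by
        field_simp
        ring
      have : 0 ≤ (n - 1) / (2 * n ^ 2 * (n + 1)) :=
        div_nonneg (by linarith) (by positivity)
      linarith
    · simp [hA]
  -- Off the accurate event the lower bound $q$ may fail, but there $q N_a^{-2} \le 1$ and the
  -- subtracted indicator absorbs it.
  have s2 : ∫ ω, (q * (2 * v * (runPulls A a t ω : ℝ)⁻¹ - v ^ 2) -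
      (accurate P α τ A X t)ᶜ.indicator (fun _ => (1 : ℝ)) ω) ∂μ ≤
      ∫ ω, runProb P α τ A X t a ω * (runPulls A a t ω : ℝ)⁻¹ ^ 2 ∂μ := by
    refine integral_mono_ae (hi4.sub hi3) hi2 ?_
    filter_upwards [hlow] with ω hω
    set x : ℝ := (runPulls A a t ω : ℝ)⁻¹ with hx
    -- The tangent of the square at $v$ makes the bound linear in $1/N_a$, in place of Jensen's
    -- inequality.
    have hx2 : 2 * v * x - v ^ 2 ≤ x ^ 2 := by nlinarith [sq_nonneg (x - v)]
    have hqx : q * (2 * v * x - v ^ 2) ≤ q * x ^ 2 := mul_le_mul_of_nonneg_left hx2 hq0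
    have hx01 := hG01 ω
    by_cases hacc : ω ∈ accurate P α τ A X t
    · have : q * x ^ 2 ≤ runProb P α τ A X t a ω * x ^ 2 :=
        mul_le_mul_of_nonneg_right (hω hacc) hx01.1
      rw [Set.indicator_of_notMem (Set.notMem_compl_iff.2 hacc)]
      linarith
    · have : 0 ≤ runProb P α τ A X t a ω * x ^ 2 :=
        mul_nonneg (runProb_nonneg P α τ A X t a ω) hx01.1
      rw [Set.indicator_of_mem (Set.mem_compl hacc)]
      nlinarith [hx01.1, hx01.2]
  rw [integral_sub hN (hi1.div_const 2), integral_div,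
    h.integral_arm_mul ht1 a hGm fun ω => (hG01 ω).1] at s1
  rw [integral_sub hi4 hi3, integral_indicator_const _ hbad, smul_eq_mul, mul_one,
    integral_const_mul, integral_sub (hN.const_mul _) (integrable_const _), integral_const_mul,
    integral_const, probReal_univ, one_smul] at s2
  have s3 := h.measureReal_compl_accurate_le hsub ht
  have s4 : 2 * (K : ℝ) / (t : ℝ) ^ 4 = 2 * (K / (t : ℝ) ^ 4) := by ring
  linarith

theorem lintegral_runEstimate_sq_le (hsub : P.SubGaussianWeights α τ) (a : Fin K) (t : ℕ) :
    ∫⁻ ω, ENNReal.ofReal (runEstimate P α A X a t ω ^ 2) ∂μ ≤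
      ENNReal.ofReal (t * (8 * Real.exp ((τ a : ℝ) ^ 2 / 2) + 2 * P.localMass α a ^ 2)) := by
  set k : 𝒳 → ℝ≥0∞ := fun x => ENNReal.ofReal (P.weight α a x ^ 2) with hk
  have hkm : Measurable k := ((P.measurable_weight α a).pow_const 2).ennreal_ofReal
  set C := 8 * Real.exp ((τ a : ℝ) ^ 2 / 2) + 2 * P.localMass α a ^ 2 with hC
  calc ∫⁻ ω, ENNReal.ofReal (runEstimate P α A X a t ω ^ 2) ∂μ
      ≤ ∫⁻ ω, ∑ l ∈ Finset.Ico 1 t, {ω | A l ω = a}.indicator (fun ω => k (X l ω)) ω ∂μ := by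
        refine lintegral_mono fun ω => ?_
        refine (ENNReal.ofReal_le_ofReal (runEstimate_sq_le a ω)).trans (le_of_eq ?_)
        rw [ENNReal.ofReal_sum_of_nonneg fun l _ => by split_ifs <;> positivity]
        refine Finset.sum_congr rfl fun l _ => ?_
        by_cases hA : A l ω = a <;> simp [hA, hk]
    _ = ∑ l ∈ Finset.Ico 1 t, ∫⁻ ω, {ω | A l ω = a}.indicator (fun ω => k (X l ω)) ω ∂μ :=
        lintegral_finsetSum _ fun l _ =>
          (hkm.comp (h.measurable_sample l)).indicator (h.measurableSet_arm l a)
    _ ≤ ∑ l ∈ Finset.Ico 1 t, ENNReal.ofReal C := by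
        refine Finset.sum_le_sum fun l hl => ?_
        have := h.lintegral_step (Finset.mem_Ico.1 hl).1 a hkm (G := fun _ => 1)
          measurable_const
        simp only [mul_one] at this
        rw [this]
        refine (mul_le_of_le_one_left' ?_).trans (hsub.lintegral_weight_sq_le a)
        calc _ ≤ ∫⁻ _, 1 ∂μ := lintegral_mono fun ω =>
              ENNReal.ofReal_le_one.2 (runProb_le_one P α τ A X l a ω)
          _ = 1 := by simp
    _ ≤ _ := by
        rw [Finset.sum_const, Nat.card_Ico, nsmul_eq_mul, ← ENNReal.ofReal_natCast,
          ← ENNReal.ofReal_mul (Nat.cast_nonneg _)]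
        refine ENNReal.ofReal_le_ofReal ?_
        gcongr
        exact Nat.sub_le t 1

theorem integrable_runEstimate_sq (hsub : P.SubGaussianWeights α τ) (a : Fin K) (t : ℕ) :
    Integrable (fun ω => runEstimate P α A X a t ω ^ 2) μ :=
  ⟨(((measurable_runEstimate P α A X a t).mono (h.past_le t) le_rfl).pow_const
    2).aestronglyMeasurable, by
    rw [hasFiniteIntegral_iff_ofReal (Eventually.of_forall fun ω => sq_nonneg _)]
    exact (h.lintegral_runEstimate_sq_le hsub a t).trans_lt ENNReal.ofReal_lt_top⟩

theorem integral_runEstimate_sq_le (hsub : P.SubGaussianWeights α τ) (a : Fin K) (t : ℕ) :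
    ∫ ω, runEstimate P α A X a t ω ^ 2 ∂μ ≤
      t * (8 * Real.exp ((τ a : ℝ) ^ 2 / 2) + 2 * P.localMass α a ^ 2) := by
  rw [integral_eq_lintegral_of_nonneg_ae (Eventually.of_forall fun ω => sq_nonneg _)
    (h.integrable_runEstimate_sq hsub a t).aestronglyMeasurable]
  exact ENNReal.toReal_le_of_le_ofReal (by positivity) (h.lintegral_runEstimate_sq_le hsub a t)

theorem ae_forall_one_le_runPulls {t : ℕ} (ht : K < t) :
    ∀ᵐ ω ∂μ, ∀ a, 1 ≤ runPulls A a t ω :=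
  ae_all_iff.2 fun a => h.ae_one_le_runPulls ht a

theorem ae_forall_estimate_eq (hsub : P.SubGaussianWeights α τ) {t : ℕ} (ht : K < t) :
    ∀ᵐ ω ∂μ, ∀ a, τ a = 0 → runEstimate P α A X a t ω = P.localMass α a := by
  rw [ae_all_iff]
  intro a
  by_cases ha : τ a = 0
  · filter_upwards [h.ae_estimate_eq hsub ha ht] with ω hω _ using hω
  · exact Eventually.of_forall fun ω ha' => absurd ha' ha

end IsRun

end Daisee

/-! ### The regret of a run, pointwise: on and off the accurate event. -/

namespace Daisee

/-- The `α`-divergence of the cell probabilities proportional to the powers of `y` from the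
cell probabilities proportional to the powers of `ζ`. -/
noncomputable def powerDivergence {K : ℕ} (α : ℝ) (ζ y : Fin K → ℝ) : ℝ :=
  ∑ a, y a ^ (1 / α) / (∑ b, y b ^ (1 / α)) * alphaLoss α
    ((ζ a ^ (1 / α) / ∑ b, ζ b ^ (1 / α)) / (y a ^ (1 / α) / ∑ b, y b ^ (1 / α)))

theorem powerDivergence_nonneg {K : ℕ} {α : ℝ} (hα : 0 < α) (ζ y : Fin K → ℝ)
    (hζ : ∀ a, 0 ≤ ζ a) (hy : ∀ a, 0 ≤ y a) : 0 ≤ powerDivergence α ζ y := by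
  have h1 : ∀ z : Fin K → ℝ, (∀ a, 0 ≤ z a) → ∀ a, 0 ≤ z a ^ (1 / α) / ∑ b, z b ^ (1 / α) :=
    fun z hz a => div_nonneg (Real.rpow_nonneg (hz a) _)
      (Finset.sum_nonneg fun b _ => Real.rpow_nonneg (hz b) _)
  exact Finset.sum_nonneg fun a _ => mul_nonneg (h1 y hy a)
    (alphaLoss_nonneg hα (div_nonneg (h1 ζ hζ a) (h1 y hy a)))

theorem measurable_powerDivergence {K : ℕ} (α : ℝ) (ζ : Fin K → ℝ) {Ω : Type*}
    [MeasurableSpace Ω] {y : Fin K → Ω → ℝ} (hy : ∀ a, Measurable (y a)) :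
    Measurable fun ω => powerDivergence α ζ fun a => y a ω := by
  have hw : ∀ a, Measurable fun ω => y a ω ^ (1 / α) / ∑ b, y b ω ^ (1 / α) := fun a =>
    ((hy a).pow_const _).div (Finset.measurable_fun_sum _ fun b _ => (hy b).pow_const _)
  exact Finset.measurable_fun_sum _ fun a _ =>
    (hw a).mul ((measurable_alphaLoss α).comp ((hw a).const_div _))

/-- The factor between the regret and the divergence of the cell probabilities. -/
noncomputable def regretScale {K : ℕ} (α Z : ℝ) (ζ : Fin K → ℝ) : ℝ :=
  (∑ b, (ζ b / Z) ^ (1 / α)) ^ α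

theorem regretScale_nonneg {K : ℕ} (α : ℝ) {Z : ℝ} (hZ : 0 < Z) (ζ : Fin K → ℝ)
    (hζ : ∀ a, 0 < ζ a) : 0 ≤ regretScale α Z ζ :=
  Real.rpow_nonneg (Finset.sum_nonneg fun b _ =>
    Real.rpow_nonneg (div_nonneg (hζ b).le hZ.le) _) _

section Run

variable {K : ℕ} {𝒳 : Type*} [MeasurableSpace 𝒳] {P : Problem K 𝒳} {α : ℝ} {τ : Fin K → ℝ≥0}
  {Ω : Type*} [MeasurableSpace Ω] {A : ℕ → Ω → Fin K} {X : ℕ → Ω → 𝒳} {μ : Measure Ω}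
  [IsProbabilityMeasure μ]

/-- The score of an arm is bounded below by a multiple of `t ^ (-1 / 2)`. -/
theorem IsRun.ae_inv_runScore_le (h : IsRun P α τ μ A X) (hsub : P.SubGaussianWeights α τ)
    (hζ : ∀ a, 0 < P.localMass α a) {t : ℕ} (ht : K < t) (ht2 : 2 ≤ t) :
    ∀ᵐ ω ∂μ, ∀ a, 0 < runScore P α τ A X a t ω ∧ (runScore P α τ A X a t ω)⁻¹ ≤
      Real.sqrt t * (if τ a = 0 then P.localMass α a
        else boostConst * τ a * Real.sqrt (Real.log 2))⁻¹ := by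
  filter_upwards [h.ae_forall_one_le_runPulls ht, h.ae_forall_estimate_eq hsub ht] with ω hN hE a
  have ht1 : (1 : ℝ) ≤ t := by exact_mod_cast (by omega : 1 ≤ t)
  have hs1 : 1 ≤ Real.sqrt t := Real.one_le_sqrt.2 ht1
  -- Without fluctuation the exact estimate bounds the score from below. Otherwise the boost alone
  -- does, since $\log t \ge \log 2$ and there are at most $t$ pulls.
  set κ := if τ a = 0 then P.localMass α a
        else boostConst * τ a * Real.sqrt (Real.log 2) with hκ
  have key : 0 < κ ∧ κ * (Real.sqrt t)⁻¹ ≤ runScore P α τ A X a t ω := by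
    rw [hκ]
    split_ifs with h0
    · refine ⟨hζ a, ?_⟩
      rw [runScore, hE a h0]
      have := mul_le_of_le_one_right (hζ a).le (inv_le_one_of_one_le₀ hs1)
      linarith [runBoost_nonneg τ A a t ω]
    · have hτ : (0 : ℝ) < τ a := NNReal.coe_pos.2 (pos_iff_ne_zero.2 h0)
      have hl : 0 < Real.sqrt (Real.log 2) := Real.sqrt_pos.2 (Real.log_pos one_lt_two)
      refine ⟨mul_pos (mul_pos boostConst_pos hτ) hl, ?_⟩
      rw [runScore]
      linarith [le_runBoost (τ := τ) ht2 (hN a), runEstimate_nonneg P α A X a t ω]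
  have hpos : 0 < κ * (Real.sqrt t)⁻¹ := mul_pos key.1 (by positivity)
  refine ⟨hpos.trans_le key.2, ?_⟩
  refine (inv_anti₀ hpos key.2).trans (le_of_eq ?_)
  rw [mul_inv, inv_inv, mul_comm]

theorem IsRun.ae_runRegret_eq (h : IsRun P α τ μ A X) (hα : 0 < α)
    (hsub : P.SubGaussianWeights α τ) (hZ : 0 < P.normConst α) (hζ : ∀ a, 0 < P.localMass α a)
    {t : ℕ} (ht : K < t) (ht2 : 2 ≤ t) (hK : 0 < K) :
    runRegret P α τ A X t =ᵐ[μ] fun ω => regretScale α (P.normConst α) (P.localMass α) *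
      powerDivergence α (P.localMass α) fun a => runScore P α τ A X a t ω := by
  filter_upwards [h.ae_inv_runScore_le hsub hζ ht ht2] with ω hω
  have hyp : ∀ a, 0 < runScore P α τ A X a t ω ^ (1 / α) := fun a =>
    Real.rpow_pos_of_pos (hω a).1 _
  have hD : 0 < ∑ b, runScore P α τ A X b t ω ^ (1 / α) :=
    Finset.sum_pos (fun b _ => hyp b) ⟨⟨0, hK⟩, Finset.mem_univ _⟩
  have hw : P.armProb α τ (fun l => A l ω) (fun l => X l ω) t = fun a =>
      runScore P α τ A X a t ω ^ (1 / α) / ∑ b, runScore P α τ A X b t ω ^ (1 / α) :=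
    funext fun a => runProb_of_lt P α τ A X ht a ω
  rw [runRegret, hw, P.regret_eq hα hZ hζ hsub.integrable_weight hsub.integrable_weight_sq _
    (fun a => div_pos (hyp a) hD) (by rw [← Finset.sum_div, div_self hD.ne'])]
  simp_rw [P.optimal_eq hα hZ hζ, P.targetMass_eq hα]
  rfl

end Run

/-- The mean inverse numbers of pulls decay at nearly the rate `1 / t`. -/
theorem exists_integral_inv_runPulls_le {K : ℕ} {α : ℝ} (hα : 0 < α) (ζ : Fin K → ℝ)
    (hζ : ∀ a, 0 < ζ a) (τ : Fin K → ℝ≥0) :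
    ∃ B, 0 ≤ B ∧ ∀ (𝒳 : Type*) [MeasurableSpace 𝒳] (P : Problem K 𝒳)
        (Ω : Type*) [MeasurableSpace Ω] (μ : Measure Ω) [IsProbabilityMeasure μ]
        (A : ℕ → Ω → Fin K) (X : ℕ → Ω → 𝒳),
        (∀ a, P.localMass α a = ζ a) → P.SubGaussianWeights α τ → IsRun P α τ μ A X →
        ∀ t, K < t → ∀ a, ∫ ω, (runPulls A a t ω : ℝ)⁻¹ ∂μ ≤ B * (t : ℝ) ^ (-(7 / 8) : ℝ) := by
  obtain ⟨c, hc, hc2, hlow⟩ := exists_prob_lower_bound hα ζ hζ τ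
  obtain ⟨B, hB, hrec⟩ := exists_recursion_bound K hc hc2
  refine ⟨B, hB, fun 𝒳 _ P Ω _ μ _ A X hPζ hsub h t ht a => ?_⟩
  refine hrec (fun t => ∫ ω, (runPulls A a t ω : ℝ)⁻¹ ∂μ)
    (fun t => h.integral_inv_runPulls_le_one a t) (fun t ht v _ => ?_) t ht
  have ht1 : 1 ≤ t := by omega
  have ht1' : (1 : ℝ) ≤ t := by exact_mod_cast ht1
  refine h.integral_inv_runPulls_succ_le hsub (by positivity) ?_ ht a ?_ v
  · have : (t : ℝ) ^ (-(1 / 8) : ℝ) ≤ 1 := Real.rpow_le_one_of_one_le_of_nonpos ht1' (by norm_num)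
    nlinarith [Real.rpow_nonneg (by linarith : (0 : ℝ) ≤ t) (-(1 / 8) : ℝ)]
  · filter_upwards [h.ae_forall_one_le_runPulls ht] with ω hN hacc
    rw [runProb_of_lt P α τ A X ht]
    refine hlow t (fun a => runScore P α τ A X a t ω) ht1' (fun b => ?_) (fun b => ?_) a
    · rw [← hPζ b]
      exact localMass_le_runScore hacc b
    · rw [← hPζ b]
      linarith [runScore_le hacc b, runBoost_le (τ := τ) ht1 (hN b)]

/-- The regret at a time is bounded by the inverse numbers of pulls if the estimates are accurate,
and by a large power of the time in general. -/
theorem exists_ae_powerDivergence_le {K : ℕ} (hK : 0 < K) {α : ℝ} (hα : 0 < α) (hα2 : α ≤ 2)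
    (ζ : Fin K → ℝ) (hζ : ∀ a, 0 < ζ a) (τ : Fin K → ℝ≥0) :
    ∃ C, 0 ≤ C ∧ ∀ (𝒳 : Type*) [MeasurableSpace 𝒳] (P : Problem K 𝒳)
        (Ω : Type*) [MeasurableSpace Ω] (μ : Measure Ω) [IsProbabilityMeasure μ]
        (A : ℕ → Ω → Fin K) (X : ℕ → Ω → 𝒳),
        (∀ a, P.localMass α a = ζ a) → P.SubGaussianWeights α τ → IsRun P α τ μ A X →
        ∀ t, K < t → ∀ᵐ ω ∂μ,
          powerDivergence α ζ (fun a => runScore P α τ A X a t ω) ≤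
          C * ((t : ℝ) ^ (1 / 8 : ℝ) * Real.log t * ∑ a, (runPulls A a t ω : ℝ)⁻¹ +
            ((t : ℝ) ^ 2)⁻¹ * ∑ a, runEstimate P α A X a t ω ^ 2 +
            (t : ℝ) ^ 3 * (accurate P α τ A X t)ᶜ.indicator 1 ω) := by
  obtain ⟨C₁, hC₁, hgood⟩ := exists_divergence_le_sq hα hα2 ζ hζ τ
  obtain ⟨C₂, hC₂, hall⟩ := exists_divergence_le hα hα2
  set κ : Fin K → ℝ := fun a => if τ a = 0 then ζ a
        else boostConst * τ a * Real.sqrt (Real.log 2) with hκ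
  have hκ0 : ∀ a, 0 ≤ κ a := fun a => by
    simp only [hκ]
    split_ifs
    · exact (hζ a).le
    · exact mul_nonneg (mul_nonneg boostConst_nonneg (τ a).2) (Real.sqrt_nonneg _)
  set T : ℝ := ∑ a, boostConst ^ 2 * (τ a : ℝ) ^ 2 with hT
  set L : ℝ := K + ∑ a, (κ a)⁻¹ with hL
  set H : ℝ := K + ∑ a, boostConst * τ a with hH
  have hT0 : 0 ≤ T := Finset.sum_nonneg fun a _ => by positivity
  have hL0 : 0 ≤ L := add_nonneg (Nat.cast_nonneg K)
    (Finset.sum_nonneg fun a _ => inv_nonneg.2 (hκ0 a))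
  have hH0 : 0 ≤ H := add_nonneg (Nat.cast_nonneg K)
    (Finset.sum_nonneg fun a _ => mul_nonneg boostConst_nonneg (τ a).2)
  refine ⟨C₁ * T + C₂ * L * (1 + H + K), by positivity, ?_⟩
  intro 𝒳 _ P Ω _ μ _ A X hPζ hsub h t ht
  have ht1 : 1 ≤ t := by omega
  have ht1' : (1 : ℝ) ≤ t := by exact_mod_cast ht1
  have hlog : 0 ≤ Real.log t := Real.log_nonneg ht1'
  filter_upwards [h.ae_forall_one_le_runPulls ht, h.ae_inv_runScore_le hsub
    (fun a => by rw [hPζ a]; exact hζ a) ht (by omega)] with ω hN hy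
  set Q₁ : ℝ := (t : ℝ) ^ (1 / 8 : ℝ) * Real.log t * ∑ a, (runPulls A a t ω : ℝ)⁻¹ with hQ₁
  set Q₂ : ℝ := ((t : ℝ) ^ 2)⁻¹ * ∑ a, runEstimate P α A X a t ω ^ 2 with hQ₂
  have hQ₁0 : 0 ≤ Q₁ := by positivity
  have hQ₂0 : 0 ≤ Q₂ := mul_nonneg (by positivity) (Finset.sum_nonneg fun a _ => sq_nonneg _)
  have hk1 : 0 ≤ C₁ * T := by positivity
  have hk2 : 0 ≤ C₂ * L * (1 + H + K) := by positivity
  by_cases hacc : ω ∈ accurate P α τ A X t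
  · rw [Set.indicator_of_notMem (Set.notMem_compl_iff.2 hacc), mul_zero, add_zero]
    have h1 := hgood t (fun a => runScore P α τ A X a t ω) (fun a => runBoost τ A a t ω) ht1'
      (fun a => by rw [← hPζ a]; exact localMass_le_runScore hacc a)
      (fun a => by rw [← hPζ a]; exact runScore_le hacc a)
      (fun a => runBoost_le ht1 (hN a))
    have h2 : ∑ a, runBoost τ A a t ω ^ 2 ≤
        T * (Real.log t * ∑ a, (runPulls A a t ω : ℝ)⁻¹) := by
      rw [Finset.mul_sum, Finset.mul_sum]
      refine Finset.sum_le_sum fun a _ => ?_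
      rw [runBoost_sq ht1]
      gcongr
      exact Finset.single_le_sum (f := fun a => boostConst ^ 2 * (τ a : ℝ) ^ 2)
        (fun a _ => by positivity) (Finset.mem_univ a)
    calc powerDivergence α ζ (fun a => runScore P α τ A X a t ω)
        ≤ C₁ * (t : ℝ) ^ (1 / 8 : ℝ) * (T * (Real.log t * ∑ a, (runPulls A a t ω : ℝ)⁻¹)) :=
          h1.trans (by gcongr)
      _ = C₁ * T * Q₁ := by rw [hQ₁]; ring
      _ ≤ _ := by nlinarith
  · rw [Set.indicator_of_mem (Set.mem_compl hacc), Pi.one_apply, mul_one]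
    set r : ℝ := Real.sqrt t with hr
    have hr2 : r ^ 2 = t := Real.sq_sqrt (by linarith)
    have hr1 : 1 ≤ r := Real.one_le_sqrt.2 ht1'
    have hr0 : 0 < r := by linarith
    have hζp : ∀ a, 0 < ζ a ^ (1 / α) := fun a => Real.rpow_pos_of_pos (hζ a) _
    have hE : 0 < ∑ b, ζ b ^ (1 / α) :=
      Finset.sum_pos (fun b _ => hζp b) ⟨⟨0, hK⟩, Finset.mem_univ _⟩
    have h1 := hall K hK (fun a => ζ a ^ (1 / α) / ∑ b, ζ b ^ (1 / α))
      (fun a => runScore P α τ A X a t ω) (fun a => (div_pos (hζp a) hE).le)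
      (by rw [← Finset.sum_div, div_self hE.ne']) (fun a => (hy a).1)
    have h2 : (K : ℝ) + ∑ a, (runScore P α τ A X a t ω)⁻¹ ≤ r * L := by
      rw [hL, mul_add, Finset.mul_sum]
      refine add_le_add (le_mul_of_one_le_left (Nat.cast_nonneg K) hr1)
        (Finset.sum_le_sum fun a _ => ?_)
      have := (hy a).2
      rwa [hPζ a] at this
    have h3 : (K : ℝ) + ∑ a, runScore P α τ A X a t ω ≤
        r * H + ∑ a, runEstimate P α A X a t ω := by
      have e1 : ∑ a, runScore P α τ A X a t ω ≤
          ∑ a, (runEstimate P α A X a t ω + r * (boostConst * τ a)) := by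
        refine Finset.sum_le_sum fun a _ => ?_
        rw [runScore]
        have e2 := runBoost_le (τ := τ) ht1 (hN a)
        have e3 : Real.sqrt (Real.log t) ≤ r :=
          Real.sqrt_le_sqrt ((Real.log_le_sub_one_of_pos (by linarith)).trans (by linarith))
        have e4 := mul_le_mul_of_nonneg_left e3 (mul_nonneg boostConst_nonneg (τ a).coe_nonneg)
        linarith
      rw [Finset.sum_add_distrib, ← Finset.mul_sum] at e1
      have e5 : (K : ℝ) ≤ r * K := le_mul_of_one_le_left (Nat.cast_nonneg K) hr1
      rw [hH, mul_add]
      linarith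
    -- Young's inequality, weighted so that both terms have mean $O(1/t)$ later: the second moments
    -- of the estimates are $O(t)$, and $t^3$ multiplies the probability $O(t^{-4})$ of the
    -- inaccurate event.
    have h4 : r * ∑ a, runEstimate P α A X a t ω ≤ Q₂ + K * (t : ℝ) ^ 3 := by
      have e1 : ∀ e : ℝ, r * e ≤ ((t : ℝ) ^ 2)⁻¹ * e ^ 2 + (t : ℝ) ^ 3 := fun e => by
        have e2 : (e / r ^ 2 - r ^ 3) ^ 2 =
            ((t : ℝ) ^ 2)⁻¹ * e ^ 2 + (t : ℝ) ^ 3 - 2 * (r * e) := by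
          rw [← hr2]
          field_simp
          ring
        have e3 : 0 ≤ ((t : ℝ) ^ 2)⁻¹ * e ^ 2 + (t : ℝ) ^ 3 := by positivity
        nlinarith [sq_nonneg (e / r ^ 2 - r ^ 3)]
      rw [hQ₂, Finset.mul_sum, Finset.mul_sum]
      refine (Finset.sum_le_sum fun a _ => e1 _).trans (le_of_eq ?_)
      simp [Finset.sum_add_distrib]
    have h5 : ((K : ℝ) + ∑ a, runScore P α τ A X a t ω) *
        (K + ∑ a, (runScore P α τ A X a t ω)⁻¹) ≤ L * (H * (t : ℝ) ^ 3 + (Q₂ + K * (t : ℝ) ^ 3)) := by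
      have e0 : 0 ≤ ∑ a, runEstimate P α A X a t ω :=
        Finset.sum_nonneg fun a _ => runEstimate_nonneg P α A X a t ω
      have e1 : 0 ≤ (K : ℝ) + ∑ a, (runScore P α τ A X a t ω)⁻¹ :=
        add_nonneg (Nat.cast_nonneg K) (Finset.sum_nonneg fun a _ => inv_nonneg.2 (hy a).1.le)
      calc _ ≤ (r * H + ∑ a, runEstimate P α A X a t ω) * (r * L) :=
            mul_le_mul h3 h2 e1 (by positivity)
        _ = L * (H * r ^ 2 + r * ∑ a, runEstimate P α A X a t ω) := by ring
        _ ≤ _ := by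
            rw [hr2]
            gcongr
            exact le_self_pow₀ ht1' three_ne_zero
    have ht3 : 0 ≤ (t : ℝ) ^ 3 := by positivity
    calc powerDivergence α ζ (fun a => runScore P α τ A X a t ω)
        ≤ C₂ * (L * (H * (t : ℝ) ^ 3 + (Q₂ + K * (t : ℝ) ^ 3))) :=
          h1.trans (mul_le_mul_of_nonneg_left h5 hC₂)
      _ = C₂ * L * (Q₂ + (H + K) * (t : ℝ) ^ 3) := by ring
      _ ≤ C₂ * L * ((1 + H + K) * (Q₁ + Q₂ + (t : ℝ) ^ 3)) := by
          gcongr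
          have : 0 ≤ (H + K) * (Q₁ + Q₂) := by positivity
          nlinarith
      _ = C₂ * L * (1 + H + K) * (Q₁ + Q₂ + (t : ℝ) ^ 3) := by ring
      _ ≤ _ := by
          exact mul_le_mul_of_nonneg_right (le_add_of_nonneg_left hk1) (by linarith)

end Daisee

/-! ### The expected regret and comparison with the stated rates. -/

namespace Daisee

/-- The expected regret of round `t` is of order `t ^ (-5 / 8)`, and it vanishes if no weight
fluctuates. -/
theorem exists_integral_runRegret_le {K : ℕ} (hK : 0 < K) {α : ℝ} (hα : α ∈ Set.Ioc (0 : ℝ) 2)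
    {Z : ℝ} (hZ : 0 < Z) (ζ : Fin K → ℝ) (hζ : ∀ a, 0 < ζ a) (τ : Fin K → ℝ≥0) :
    ∃ C, 0 ≤ C ∧ ∀ (𝒳 : Type*) [MeasurableSpace 𝒳] (P : Problem K 𝒳)
        (Ω : Type*) [MeasurableSpace Ω] (μ : Measure Ω) [IsProbabilityMeasure μ]
        (A : ℕ → Ω → Fin K) (X : ℕ → Ω → 𝒳),
        P.normConst α = Z → (∀ a, P.localMass α a = ζ a) → P.SubGaussianWeights α τ →
        IsRun P α τ μ A X → ∀ t, K < t →
          Integrable (runRegret P α τ A X t) μ ∧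
          ∫ ω, runRegret P α τ A X t ω ∂μ ≤ C * (t : ℝ) ^ (-(5 / 8) : ℝ) ∧
          ((∀ a, τ a = 0) → ∫ ω, runRegret P α τ A X t ω ∂μ ≤ 0) := by
  obtain ⟨hα0, hα2⟩ := hα
  obtain ⟨B, hB, hpulls⟩ := exists_integral_inv_runPulls_le hα0 ζ hζ τ
  obtain ⟨C, hC, hdiv⟩ := exists_ae_powerDivergence_le hK hα0 hα2 ζ hζ τ
  obtain ⟨C₁, hC₁, hexact⟩ := exists_divergence_le_sq hα0 hα2 ζ hζ τ
  set S := regretScale α Z ζ with hS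
  have hS0 : 0 ≤ S := regretScale_nonneg α hZ ζ hζ
  set M := ∑ a, (8 * Real.exp ((τ a : ℝ) ^ 2 / 2) + 2 * ζ a ^ 2) with hM
  have hM0 : 0 ≤ M := Finset.sum_nonneg fun a _ => by positivity
  refine ⟨S * (C * (8 * (K * B) + M + 2 * K)), by positivity, ?_⟩
  intro 𝒳 _ P Ω _ μ _ A X hPZ hPζ hsub h t ht
  have hPζ' : P.localMass α = ζ := funext hPζ
  have ht1 : 1 ≤ t := by omega
  have ht1' : (1 : ℝ) ≤ t := by exact_mod_cast ht1
  have ht0 : (0 : ℝ) < t := by linarith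
  have hlog : 0 ≤ Real.log t := Real.log_nonneg ht1'
  have hm := h.past_le t
  have heq := h.ae_runRegret_eq hα0 hsub (by rw [hPZ]; exact hZ) (fun a => by rw [hPζ a]; exact hζ a)
    ht (by omega) hK
  rw [hPZ, hPζ', ← hS] at heq
  set F : Ω → ℝ := fun ω => powerDivergence α ζ fun a => runScore P α τ A X a t ω with hF
  have hF0 : ∀ ω, 0 ≤ F ω := fun ω => powerDivergence_nonneg hα0 ζ _ (fun a => (hζ a).le)
    fun a => runScore_nonneg P α τ A X a t ω
  have hFm : Measurable F := measurable_powerDivergence α ζ fun a =>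
    (measurable_runScore P α τ A X a t).mono hm le_rfl
  set G : Ω → ℝ := fun ω =>
    C * ((t : ℝ) ^ (1 / 8 : ℝ) * Real.log t * ∑ a, (runPulls A a t ω : ℝ)⁻¹ +
            ((t : ℝ) ^ 2)⁻¹ * ∑ a, runEstimate P α A X a t ω ^ 2 +
            (t : ℝ) ^ 3 * (accurate P α τ A X t)ᶜ.indicator 1 ω) with hG
  have hFG : F ≤ᵐ[μ] G := hdiv 𝒳 P Ω μ A X hPζ hsub h t ht
  have hbad : MeasurableSet (accurate P α τ A X t)ᶜ :=
    (hm _ (measurableSet_accurate P α τ A X t)).compl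
  have i1 : Integrable (fun ω => (t : ℝ) ^ (1 / 8 : ℝ) * Real.log t *
      ∑ a, (runPulls A a t ω : ℝ)⁻¹) μ :=
    (integrable_finsetSum _ fun a _ => h.integrable_inv_runPulls a t).const_mul _
  have i2 : Integrable (fun ω => ((t : ℝ) ^ 2)⁻¹ * ∑ a, runEstimate P α A X a t ω ^ 2) μ :=
    (integrable_finsetSum _ fun a _ => h.integrable_runEstimate_sq hsub a t).const_mul _
  have i3 : Integrable (fun ω => (t : ℝ) ^ 3 *
      (accurate P α τ A X t)ᶜ.indicator (1 : Ω → ℝ) ω) μ :=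
    (((integrable_const (1 : ℝ)).indicator hbad).congr
      (Eventually.of_forall fun ω => rfl)).const_mul _
  have i12 : Integrable (fun ω => (t : ℝ) ^ (1 / 8 : ℝ) * Real.log t *
      ∑ a, (runPulls A a t ω : ℝ)⁻¹ +
      ((t : ℝ) ^ 2)⁻¹ * ∑ a, runEstimate P α A X a t ω ^ 2) μ := i1.add i2
  have iG : Integrable G μ := (i12.add i3).const_mul C
  have iF : Integrable F μ := iG.mono' hFm.aestronglyMeasurable (by
    filter_upwards [hFG] with ω hω
    rwa [Real.norm_of_nonneg (hF0 ω)])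
  have hint : ∫ ω, runRegret P α τ A X t ω ∂μ = S * ∫ ω, F ω ∂μ := by
    rw [integral_congr_ae heq, integral_const_mul]
  refine ⟨(iF.const_mul S).congr heq.symm, ?_, fun hτ => ?_⟩
  -- The main term. With $\log t \le 8 t^{1/8}$ the exponents add up to $\tfrac18 + \tfrac18 -
  -- \tfrac78 = -\tfrac58$; the two other terms are $O(1/t)$.
  · have b1 : (t : ℝ) ^ (1 / 8 : ℝ) * Real.log t * ∑ a, ∫ ω, (runPulls A a t ω : ℝ)⁻¹ ∂μ ≤
        8 * (K * B) * (t : ℝ) ^ (-(5 / 8) : ℝ) := by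
      have e1 : ∑ a, ∫ ω, (runPulls A a t ω : ℝ)⁻¹ ∂μ ≤ K * (B * (t : ℝ) ^ (-(7 / 8) : ℝ)) := by
        refine (Finset.sum_le_sum fun a _ => hpulls 𝒳 P Ω μ A X hPζ hsub h t ht a).trans ?_
        simp
      have e2 := Real.log_le_rpow_div ht0.le (ε := 1 / 8) (by norm_num)
      have e3 : (t : ℝ) ^ (1 / 8 : ℝ) * (t : ℝ) ^ (1 / 8 : ℝ) * (t : ℝ) ^ (-(7 / 8) : ℝ) =
          (t : ℝ) ^ (-(5 / 8) : ℝ) := by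
        rw [← Real.rpow_add ht0, ← Real.rpow_add ht0]
        norm_num
      calc _ ≤ (t : ℝ) ^ (1 / 8 : ℝ) * ((t : ℝ) ^ (1 / 8 : ℝ) / (1 / 8)) *
            (K * (B * (t : ℝ) ^ (-(7 / 8) : ℝ))) := by gcongr
        _ = 8 * (K * B) * ((t : ℝ) ^ (1 / 8 : ℝ) * (t : ℝ) ^ (1 / 8 : ℝ) *
            (t : ℝ) ^ (-(7 / 8) : ℝ)) := by ring
        _ = _ := by rw [e3]
    have hinv : (t : ℝ)⁻¹ ≤ (t : ℝ) ^ (-(5 / 8) : ℝ) := by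
      rw [← Real.rpow_neg_one]
      exact Real.rpow_le_rpow_of_exponent_le ht1' (by norm_num)
    have b2 : ((t : ℝ) ^ 2)⁻¹ * ∑ a, ∫ ω, runEstimate P α A X a t ω ^ 2 ∂μ ≤
        M * (t : ℝ) ^ (-(5 / 8) : ℝ) := by
      have e1 : ∑ a, ∫ ω, runEstimate P α A X a t ω ^ 2 ∂μ ≤ t * M := by
        rw [hM, Finset.mul_sum]
        refine Finset.sum_le_sum fun a _ => ?_
        rw [← hPζ a]
        exact h.integral_runEstimate_sq_le hsub a t
      calc _ ≤ ((t : ℝ) ^ 2)⁻¹ * (t * M) := by gcongr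
        _ = M * (t : ℝ)⁻¹ := by field_simp
        _ ≤ _ := by gcongr
    have b3 : (t : ℝ) ^ 3 * μ.real (accurate P α τ A X t)ᶜ ≤
        2 * K * (t : ℝ) ^ (-(5 / 8) : ℝ) := by
      calc _ ≤ (t : ℝ) ^ 3 * (2 * K / (t : ℝ) ^ 4) := by
            gcongr
            exact h.measureReal_compl_accurate_le hsub ht
        _ = 2 * K * (t : ℝ)⁻¹ := by field_simp
        _ ≤ _ := by gcongr
    have hGint : ∫ ω, G ω ∂μ = C * ((t : ℝ) ^ (1 / 8 : ℝ) * Real.log t *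
        ∑ a, ∫ ω, (runPulls A a t ω : ℝ)⁻¹ ∂μ +
        ((t : ℝ) ^ 2)⁻¹ * ∑ a, ∫ ω, runEstimate P α A X a t ω ^ 2 ∂μ +
        (t : ℝ) ^ 3 * μ.real (accurate P α τ A X t)ᶜ) := by
      rw [hG, integral_const_mul, integral_add i12 i3, integral_add i1 i2, integral_const_mul,
        integral_const_mul, integral_const_mul, integral_indicator_one hbad,
        integral_finsetSum _ fun a _ => h.integrable_inv_runPulls a t,
        integral_finsetSum _ fun a _ => h.integrable_runEstimate_sq hsub a t]
    rw [hint, mul_assoc, mul_assoc]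
    refine mul_le_mul_of_nonneg_left ?_ hS0
    refine (integral_mono_ae iF iG hFG).trans ?_
    rw [hGint]
    refine mul_le_mul_of_nonneg_left ?_ hC
    linarith
  -- With all $\tau_a = 0$ the boosts vanish and the scores equal the masses, so the quadratic bound
  -- applies with $\sigma = 0$.
  · rw [hint]
    refine mul_nonpos_of_nonneg_of_nonpos hS0 (integral_nonpos_of_ae ?_)
    filter_upwards [h.ae_forall_estimate_eq hsub ht] with ω hω
    have hy : ∀ a, runScore P α τ A X a t ω = ζ a := fun a => by
      rw [runScore, hω a (hτ a), runBoost_eq, hτ a, hPζ a]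
      simp
    have := hexact t (fun a => runScore P α τ A X a t ω) (fun _ => 0) ht1'
      (fun a => (hy a).ge) (fun a => by simpa using (hy a).le) (fun a => by simp [hτ a])
    exact this.trans (le_of_eq (by simp))

theorem rate_nonneg (α : ℝ) {t : ℕ} (ht : 1 ≤ t) : 0 ≤ rate α t :=
  mul_nonneg (by positivity) (Real.rpow_nonneg (Real.log_nonneg (by exact_mod_cast ht)) _)

/-- A factor $t^{-1/8}$ is to spare, and the power of the logarithm is eventually at least $1$
because its exponent is nonnegative. -/
theorem isLittleO_rate {α : ℝ} (hα : 0 < α) :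
    (fun t : ℕ => (t : ℝ) ^ (-(5 / 8) : ℝ)) =o[atTop] rate α := by
  rw [isLittleO_iff]
  intro c hc
  have h1 : Tendsto (fun t : ℕ => (t : ℝ) ^ (-(1 / 8) : ℝ)) atTop (𝓝 0) :=
    (tendsto_rpow_neg_atTop (by norm_num)).comp tendsto_natCast_atTop_atTop
  have h2 : Tendsto (fun t : ℕ => Real.log t) atTop atTop :=
    Real.tendsto_log_atTop.comp tendsto_natCast_atTop_atTop
  filter_upwards [h1.eventually_le_const hc, h2.eventually_ge_atTop 1, eventually_ge_atTop 1]
    with t ht1 ht2 ht3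
  have ht0 : (0 : ℝ) < t := by exact_mod_cast ht3
  have he : 0 ≤ logExponent α := by
    unfold logExponent
    positivity
  have hl : 1 ≤ Real.log t ^ logExponent α := Real.one_le_rpow ht2 he
  rw [Real.norm_of_nonneg (by positivity), Real.norm_of_nonneg (rate_nonneg α ht3), rate]
  have e : (t : ℝ) ^ (-(5 / 8) : ℝ) = (t : ℝ) ^ (-(1 / 8) : ℝ) * (Real.sqrt t)⁻¹ := by
    rw [Real.sqrt_eq_rpow, ← Real.rpow_neg ht0.le, ← Real.rpow_add ht0]
    norm_num
  rw [e]
  have hs : 0 < (Real.sqrt t)⁻¹ := by positivity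
  calc _ ≤ c * ((Real.sqrt t)⁻¹ * 1) := by rw [mul_one]; gcongr
    _ ≤ _ := by gcongr

/-- Telescoping of $1/\sqrt{T+1} \le 2(\sqrt{T+1} - \sqrt T)$. -/
theorem sum_Ioc_inv_sqrt_le (K T : ℕ) :
    ∑ t ∈ Finset.Ioc K T, (Real.sqrt t)⁻¹ ≤ 2 * Real.sqrt T := by
  induction T with
  | zero => simp
  | succ T ih =>
    rcases le_or_gt (T + 1) K with hT | hT
    · rw [Finset.Ioc_eq_empty (by omega)]
      simp
    · rw [Finset.sum_Ioc_succ_top (by omega)]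
      have h1 : 0 < Real.sqrt ((T + 1 : ℕ) : ℝ) := Real.sqrt_pos.2 (by positivity)
      have h2 : Real.sqrt ((T + 1 : ℕ) : ℝ) ^ 2 = T + 1 := by
        rw [Real.sq_sqrt (by positivity)]
        push_cast
        ring
      have h3 : Real.sqrt (T : ℝ) ^ 2 = T := Real.sq_sqrt (by positivity)
      have h4 : (Real.sqrt ((T + 1 : ℕ) : ℝ))⁻¹ ≤
          2 * Real.sqrt ((T + 1 : ℕ) : ℝ) - 2 * Real.sqrt (T : ℝ) := by
        rw [inv_le_iff_one_le_mul₀ h1]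
        nlinarith [sq_nonneg (Real.sqrt ((T + 1 : ℕ) : ℝ) - Real.sqrt (T : ℝ))]
      linarith

theorem leadingConst_nonneg {K : ℕ} (α : ℝ) {Z : ℝ} (hZ : 0 < Z) (ζ : Fin K → ℝ)
    (hζ : ∀ a, 0 < ζ a) (τ : Fin K → ℝ≥0) : 0 ≤ leadingConst α Z ζ τ := by
  have h1 : 0 ≤ ∑ a, (τ a : ℝ) * ζ a ^ (1 / (2 * α) - 1) :=
    Finset.sum_nonneg fun a _ => mul_nonneg (τ a).coe_nonneg (Real.rpow_nonneg (hζ a).le _)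
  have h2 := Real.rpow_nonneg boostConst_nonneg (1 / (2 * α) + 1)
  unfold leadingConst
  positivity

theorem leadingConst_pos {K : ℕ} {α : ℝ} (hα : 0 < α) {Z : ℝ} (hZ : 0 < Z) (ζ : Fin K → ℝ)
    (hζ : ∀ a, 0 < ζ a) (τ : Fin K → ℝ≥0) {a : Fin K} (ha : τ a ≠ 0) :
    0 < leadingConst α Z ζ τ := by
  have hτ : (0 : ℝ) < τ a := NNReal.coe_pos.2 (pos_iff_ne_zero.2 ha)
  have hK : (0 : ℝ) < K := by exact_mod_cast a.pos
  have h1 : 0 < ∑ a, (τ a : ℝ) * ζ a ^ (1 / (2 * α) - 1) :=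
    Finset.sum_pos' (fun a _ => mul_nonneg (τ a).coe_nonneg (Real.rpow_nonneg (hζ a).le _))
      ⟨a, Finset.mem_univ a, mul_pos hτ (Real.rpow_pos_of_pos (hζ a) _)⟩
  have h2 := Real.rpow_pos_of_pos boostConst_pos (1 / (2 * α) + 1)
  have h3 : 0 < ∑ a, (τ a : ℝ) ^ (1 / α) :=
    Finset.sum_pos' (fun a _ => Real.rpow_nonneg (τ a).coe_nonneg _)
      ⟨a, Finset.mem_univ a, Real.rpow_pos_of_pos hτ _⟩
  unfold leadingConst
  positivity

end Daisee

theorem theorem2 {K : ℕ} (hK : 0 < K) (α : ℝ) (hα : α ∈ Set.Ioc (0 : ℝ) 2)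
    (Z : ℝ) (hZ : 0 < Z) (ζ : Fin K → ℝ) (hζ : ∀ a, 0 < ζ a) (τ : Fin K → ℝ≥0) :
    (∃ (ε : ℕ → ℝ) (t₀ : ℕ) (C : ℝ), ε =o[atTop] Daisee.rate α ∧
      ∀ (𝒳 : Type*) [MeasurableSpace 𝒳] (P : Daisee.Problem K 𝒳)
        (Ω : Type*) [MeasurableSpace Ω] (μ : Measure Ω) [IsProbabilityMeasure μ]
        (A : ℕ → Ω → Fin K) (X : ℕ → Ω → 𝒳),
        P.normConst α = Z → (∀ a, P.localMass α a = ζ a) → P.SubGaussianWeights α τ →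
        Daisee.IsRun P α τ μ A X →
          (∀ t, K < t → Integrable (Daisee.runRegret P α τ A X t) μ ∧
            ∫ ω, Daisee.runRegret P α τ A X t ω ∂μ
              ≤ Daisee.leadingConst α Z ζ τ * Daisee.rate α t + ε t) ∧
          (∀ t, K < t → t₀ ≤ t →
            ∫ ω, Daisee.runRegret P α τ A X t ω ∂μ
              ≤ Daisee.leadingConst α Z ζ τ * Daisee.rate α t) ∧
          (∀ T, K < T →
            ∑ t ∈ Finset.Ioc K T, ∫ ω, Daisee.runRegret P α τ A X t ω ∂μ
              ≤ C * Daisee.cumulativeRate α T)) ∧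
    (∀ T : ℕ, Tendsto (fun β => Daisee.cumulativeRate β T) (𝓝 1)
      (𝓝 (Real.sqrt T * Real.log T ^ (3 / 4 : ℝ)))) ∧
    (∀ r : ℝ, 0 ≤ r → Tendsto (fun β => Daisee.alphaLoss β r) (𝓝[≠] 1)
      (𝓝 (Daisee.alphaLoss 1 r))) := by
  refine ⟨?_, fun T => Daisee.tendsto_cumulativeRate T, fun r hr => Daisee.tendsto_alphaLoss hr⟩
  obtain ⟨C, hC, hreg⟩ := Daisee.exists_integral_runRegret_le hK hα hZ ζ hζ τ
  have hM0 := Daisee.leadingConst_nonneg α hZ ζ hζ τ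
  have ho : (fun t : ℕ => C * (t : ℝ) ^ (-(5 / 8) : ℝ)) =o[atTop] Daisee.rate α :=
    (Daisee.isLittleO_rate hα.1).const_mul_left C
  -- A little-o bound can be compared with the leading term only if its constant is positive, which
  -- requires a fluctuating arm. Otherwise that constant is $0$, and the nonpositivity of the
  -- expected regret is used instead.
  have ht₀ : ∃ t₀ : ℕ, (∃ a, τ a ≠ 0) → ∀ t, t₀ ≤ t → 1 ≤ t →
      C * (t : ℝ) ^ (-(5 / 8) : ℝ) ≤ Daisee.leadingConst α Z ζ τ * Daisee.rate α t := by
    by_cases hτ : ∃ a, τ a ≠ 0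
    · obtain ⟨a, ha⟩ := hτ
      obtain ⟨t₀, h₀⟩ := eventually_atTop.1
        (isLittleO_iff.1 ho (Daisee.leadingConst_pos hα.1 hZ ζ hζ τ ha))
      refine ⟨t₀, fun _ t ht ht1 => ?_⟩
      have := h₀ t ht
      rw [Real.norm_of_nonneg (Daisee.rate_nonneg α ht1)] at this
      exact (Real.le_norm_self _).trans this
    · exact ⟨0, fun h => absurd h hτ⟩
  obtain ⟨t₀, ht₀⟩ := ht₀
  have hl2 : 0 < Real.log 2 ^ Daisee.logExponent α :=
    Real.rpow_pos_of_pos (Real.log_pos one_lt_two) _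
  -- In the cumulative constant, $2$ comes from summing $t^{-1/2} \ge t^{-5/8}$, and the inverse
  -- power of $\log 2$ inserts the logarithmic factor, since $T > K \ge 1$ gives $T \ge 2$.
  refine ⟨fun t => C * (t : ℝ) ^ (-(5 / 8) : ℝ), t₀,
    C * (2 * (Real.log 2 ^ Daisee.logExponent α)⁻¹), ho, ?_⟩
  intro 𝒳 _ P Ω _ μ _ A X hPZ hPζ hsub h
  have hR := hreg 𝒳 P Ω μ A X hPZ hPζ hsub h
  refine ⟨fun t ht => ⟨(hR t ht).1, ?_⟩, fun t ht htt => ?_, fun T hT => ?_⟩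
  · have := mul_nonneg hM0 (Daisee.rate_nonneg α (by omega : 1 ≤ t))
    linarith [(hR t ht).2.1]
  · by_cases hτ : ∃ a, τ a ≠ 0
    · exact (hR t ht).2.1.trans (ht₀ hτ t htt (by omega))
    · push Not at hτ
      exact ((hR t ht).2.2 hτ).trans (mul_nonneg hM0 (Daisee.rate_nonneg α (by omega)))
  · have h1 : ∑ t ∈ Finset.Ioc K T, ∫ ω, Daisee.runRegret P α τ A X t ω ∂μ ≤
        ∑ t ∈ Finset.Ioc K T, C * (Real.sqrt t)⁻¹ := by
      refine Finset.sum_le_sum fun t ht => ?_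
      have htK := (Finset.mem_Ioc.1 ht).1
      refine (hR t htK).2.1.trans (mul_le_mul_of_nonneg_left ?_ hC)
      have ht1 : (1 : ℝ) ≤ t := by exact_mod_cast (by omega : 1 ≤ t)
      rw [Real.sqrt_eq_rpow, ← Real.rpow_neg (by linarith)]
      exact Real.rpow_le_rpow_of_exponent_le ht1 (by norm_num)
    have hT2 : (2 : ℝ) ≤ T := by exact_mod_cast (by omega : 2 ≤ T)
    have he : 0 ≤ Daisee.logExponent α := by
      have := hα.1
      unfold Daisee.logExponent
      positivity
    have h2 : Real.log 2 ^ Daisee.logExponent α ≤ Real.log T ^ Daisee.logExponent α :=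
      Real.rpow_le_rpow (Real.log_nonneg one_le_two) (Real.log_le_log two_pos hT2) he
    rw [← Finset.mul_sum] at h1
    refine h1.trans ?_
    rw [mul_assoc]
    refine mul_le_mul_of_nonneg_left ((Daisee.sum_Ioc_inv_sqrt_le K T).trans ?_) hC
    rw [Daisee.cumulativeRate]
    calc 2 * Real.sqrt T = 2 * (Real.log 2 ^ Daisee.logExponent α)⁻¹ *
          (Real.sqrt T * Real.log 2 ^ Daisee.logExponent α) := by field_simp
      _ ≤ _ := by gcongr
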